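/- Let $W$ be a memoryless channel with binary input $\{0,1\}$ and arbitrary output space, with transition densities $W(y\mid x)$ relative to a $\sigma$-finite reference measure $\nu$, and let $$I(W)=\sum_{x\in\{0,1\}}\tfrac12\int W(y\mid x)\log_2\frac{W(y\mid x)}{\tfrac12W(y\mid 0)+\tfrac12W(y\mid 1)}\,d\nu(y)$$ be its symmetric capacity. For $n\ge 0$ let $G_{2^n}=B_{2^n}F^{\otimes n}$ be the polar transform, where $F=\begin{pmatrix}1&0\\1&1\end{pmatrix}$ and $B_{2^n}$ is the bit-reversal permutation. Fix integers $m\ge 0$ and $0\le\lambda\le 2^m$, and put $\tau=\lambda/2^m$. For block length $N=2^{n+1}$, the Partially Polarized Polar (PPP) transform with partial polarization ratio $\tau$ maps $u=(u^{(1)},u^{(2)})\in\mathbb F_2^{N/2}\times\mathbb F_2^{N/2}$ to $(a',b)$, where $a=u^{(1)}G_{N/2}$, $b=u^{(2)}G_{N/2}$ and, for $0\le j<N/2$, $a'_j=a_j+b_j$ if $j \bmod 2^m<\lambda$ and $a'_j=a_j$ otherwise. A PPP code is given by a set $A\subseteq\{0,\dots,N-1\}$ of information positions and values for the frozen bits $u_i$,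 $i\notin A$; the bits $u_i$, $i\in A$, are uniformly distributed. The successive cancellation (SC) decoder determines $\hat u_0,\hat u_1,\dots,\hat u_{N-1}$ in this order: it sets $\hat u_i=u_i$ for $i\notin A$, and for $i\in A$ it decides $\hat u_i$ by maximum likelihood from the channel output and $\hat u_0,\dots,\hat u_{i-1}$, with $u_{i+1},\dots,u_{N-1}$ treated as independent uniform bits (ties are decided as $0$). Then PPP codes with ratio $\tau$ achieve the symmetric capacity of $W$ under SC decoding: for every $R<I(W)$ there are sets $A_n\subseteq\{0,\dots,N-1\}$, $N=2^{n+1}$, with $|A_n|\ge RN$ for all $n$, such that the block error probability under SC decoding of the PPP code with information set $A_n$, averaged over uniformly distributed frozen bits, tends to $0$ as $n\to\infty$; in particular, for the same sets $A_n$ there are choices of frozen bits for which the block error probability of the resulting PPP codes tends to $0$. -/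

import Mathlib

open MeasureTheory Filter Topology
open scoped NNReal ENNReal

/-- A (not necessarily symmetric) binary-input channel with an arbitrary measurable output space:
transition densities `W(y | x)`, `x ∈ {0, 1}`, with respect to a σ-finite reference measure.
Discrete outputs are the case of the counting measure and additive Gaussian noise that of the
Lebesgue measure; since any two probability laws `P₀, P₁` have densities with respect to
`P₀ + P₁`, every pair of output laws is covered. -/
structure BinaryChannel (Y : Type*) [MeasurableSpace Y] where
  ref : Measure Y
  sigmaFinite_ref : SigmaFinite ref
  density : ZMod 2 → Y → ℝ≥0
  measurable_density : ∀ x, Measurable (density x)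
  lintegral_density : ∀ x, ∫⁻ y, (density x y : ℝ≥0∞) ∂ref = 1

namespace BinaryChannel

variable {Y : Type*} [MeasurableSpace Y]

/-- The law of the channel output given the input bit `x`. -/
noncomputable def law (W : BinaryChannel Y) (x : ZMod 2) : Measure Y :=
  W.ref.withDensity (fun y => (W.density x y : ℝ≥0∞))

instance isProbabilityMeasure_law (W : BinaryChannel Y) (x : ZMod 2) :
    IsProbabilityMeasure (W.law x) :=
  ⟨by simp [law, W.lintegral_density x]⟩

/-- The law of the output word when the word `x` is sent over `N` independent uses of the
channel (memorylessness). -/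
noncomputable def wordLaw (W : BinaryChannel Y) {N : ℕ} (x : Fin N → ZMod 2) :
    Measure (Fin N → Y) :=
  Measure.pi (fun k => W.law (x k))

/-- The symmetric capacity, in bits: the mutual information between a uniform input bit and the
channel output. (The integrand is always integrable.) -/
noncomputable def symmetricCapacity (W : BinaryChannel Y) : ℝ :=
  ∑ x : ZMod 2, (1 / 2 : ℝ) * ∫ y, (W.density x y : ℝ) *
    Real.logb 2 ((W.density x y : ℝ) /
      ((1 / 2 : ℝ) * (W.density 0 y : ℝ) + (1 / 2 : ℝ) * (W.density 1 y : ℝ))) ∂W.ref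

/-- The density of the output `(y, past)` of the `i`-th synthesized bit-channel given that its
input `u_i` is `b`, for the encoder `enc`:
`2^{-(N-1)} ∑ W^N(y | enc(u))` over all `u` with `u_j = past_j` for `j < i` and `u_i = b`. -/
noncomputable def bitChannel (W : BinaryChannel Y) {N : ℕ}
    (enc : (Fin N → ZMod 2) → (Fin N → ZMod 2)) (i : Fin N)
    (y : Fin N → Y) (past : Fin N → ZMod 2) (b : ZMod 2) : ℝ≥0 :=
  ((2 : ℝ≥0) ^ (N - 1))⁻¹ *
    ∑ u : Fin N → ZMod 2 with (∀ j, j < i → u j = past j) ∧ u i = b,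
      ∏ k, W.density (enc u k) (y k)

/-- Successive cancellation decoding: the bits are decided in the order `0, 1, …, N - 1`. A frozen
bit (`i ∉ A`) is known to be `frozen i`; an information bit is decided by maximum likelihood on
its bit-channel, from the channel output and the previous decisions (ties give `0`). -/
noncomputable def scDecode (W : BinaryChannel Y) {N : ℕ}
    (enc : (Fin N → ZMod 2) → (Fin N → ZMod 2)) (A : Finset (Fin N))
    (frozen : Fin N → ZMod 2) (y : Fin N → Y) (i : Fin N) : ZMod 2 :=
  let past : Fin N → ZMod 2 := fun j => if _h : j < i then scDecode W enc A frozen y j else 0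
  if i ∈ A then
    if W.bitChannel enc i y past 1 ≤ W.bitChannel enc i y past 0 then 0 else 1
  else frozen i
termination_by i

/-- Block error probability under successive cancellation decoding of the code with encoder `enc`,
information set `A` and frozen bits `frozen i`, `i ∉ A` (the other values of `frozen` play no
role), for uniformly distributed information bits. -/
noncomputable def blockErrorProb (W : BinaryChannel Y) {N : ℕ}
    (enc : (Fin N → ZMod 2) → (Fin N → ZMod 2)) (A : Finset (Fin N))
    (frozen : Fin N → ZMod 2) : ℝ :=
  ((2 : ℝ) ^ A.card)⁻¹ * ∑ u : Fin N → ZMod 2 with ∀ i, i ∉ A → u i = frozen i,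
    (W.wordLaw (enc u)).real {y | W.scDecode enc A frozen y ≠ u}

/-- The block error probability averaged over uniformly distributed frozen bits. -/
noncomputable def avgBlockErrorProb (W : BinaryChannel Y) {N : ℕ}
    (enc : (Fin N → ZMod 2) → (Fin N → ZMod 2)) (A : Finset (Fin N)) : ℝ :=
  ((2 : ℝ) ^ N)⁻¹ * ∑ frozen : Fin N → ZMod 2, W.blockErrorProb enc A frozen

end BinaryChannel

/-- The first half of a word of length `2 ^ (n + 1)`. -/
def firstHalf {n : ℕ} (u : Fin (2 ^ (n + 1)) → ZMod 2) : Fin (2 ^ n) → ZMod 2 :=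
  fun i => u ⟨i.1, by have := i.2; have := pow_succ 2 n; omega⟩

/-- The second half of a word of length `2 ^ (n + 1)`. -/
def secondHalf {n : ℕ} (u : Fin (2 ^ (n + 1)) → ZMod 2) : Fin (2 ^ n) → ZMod 2 :=
  fun i => u ⟨2 ^ n + i.1, by have := i.2; have := pow_succ 2 n; omega⟩

/-- The polar transform `u ↦ u G_N` of length `N = 2 ^ n`, where `G_N = B_N F^{⊗ n}` with the
kernel `F = [[1, 0], [1, 1]]` and the bit-reversal permutation `B_N`. If `a` and `b` are the
transforms of the two halves of `u`, then the transform of `u` is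
`(a_0 + b_0, b_0, a_1 + b_1, b_1, …)`; so the polarization layer nearest to the channel combines
neighbouring positions. -/
def polarTransform : (n : ℕ) → (Fin (2 ^ n) → ZMod 2) → (Fin (2 ^ n) → ZMod 2)
  | 0, u => u
  | n + 1, u => fun j =>
      let k : Fin (2 ^ n) := ⟨j.1 / 2, by have := j.2; have := pow_succ 2 n; omega⟩
      if j.1 % 2 = 0 then
        polarTransform n (firstHalf u) k + polarTransform n (secondHalf u) k
      else polarTransform n (secondHalf u) k

/-- The partially polarized polar transform of length `N = 2 ^ (n + 1)` with partial polarization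
ratio `lam / 2 ^ m`. The two segments of `u`, of length `N / 2` each, are polar transformed into
`a` and `b`, and the inter-segment layer sends `(a, b)` to `(a', b)`, where of the `N / 2` XOR
operations `a'_j = a_j + b_j` of a full polarization layer only the first `lam` out of every
`2 ^ m` consecutive ones are retained (and `a'_j = a_j` for the others). -/
def pppTransform (m lam n : ℕ) (u : Fin (2 ^ (n + 1)) → ZMod 2) : Fin (2 ^ (n + 1)) → ZMod 2 :=
  let a := polarTransform n (firstHalf u)
  let b := polarTransform n (secondHalf u)
  fun j =>
    if h : j.1 < 2 ^ n then
      if j.1 % 2 ^ m < lam then a ⟨j.1, h⟩ + b ⟨j.1, h⟩ else a ⟨j.1, h⟩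
    else b ⟨j.1 - 2 ^ n, by have := j.2; have := pow_succ 2 n; omega⟩

/-! A channel is represented by the law of its soft bit d = P(0 | y) - P(1 | y) under uniform input,
and one XOR layer by the two operations `checkLaw` and `varLaw` on such laws. All inputs, frozen
bits included, are averaged uniformly, so no symmetry of the channel is needed.

Three means over d carry the argument: the Bhattacharyya parameter Z (`bhatt`), the second moment S
(`softPower`) and the conditional entropy H (`condEntropy`). An XOR multiplies Z on the better side
and S on the worse side, and on the other side gives at most x + y - xy. H is conserved by every
pair, whether its XOR is retained or omitted. The potential √(ZS) shrinks on average by the factor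
99/100 per layer, so most synthesized channels have Z or S small. Small S forces H near 1, so
conservation of H bounds the fraction with large Z by H plus a small error. Further layers push Z of
almost all remaining channels below a multiple of 4^(-n) (`polarSum_unreliable_le`,
`eventually_polarSum_unreliable_const`).

After the partial inter-segment layer each segment sees a family of channels with period 2^m. The
polar layers nearest to the channel combine neighbours, so m of them turn the family into 2^m
constant families with the same total entropy, each of which polarizes as usual
(`eventually_polarSum_unreliable`). The two segments together have mean entropy H = 1 - I(W),
whatever the ratio, hence any rate below I(W) is available.

For decoding, `IsPartialLayer` shows that the bit-channels of the actual encoders obey the recursion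
on laws. The error of a maximum likelihood decision with known past, averaged over all inputs, is at
most Z/2 (`sum_wordLaw_bitErrorSet_le`). The first wrong decision of the SC decoder is such an
error, so a union bound over at most 2^(n+1) positions, each contributing at most 4^(-n), finishes
the proof. -/

/-! ### Soft bits and their transformation by a single XOR. -/

/-- The possible values of `P(x = 0 | output) - P(x = 1 | output)` for a uniform input bit `x`. -/
abbrev SoftBit := Set.Icc (-1 : ℝ) 1

/-- The character `x ↦ (-1) ^ x` of `ZMod 2`. -/
def bitSign (x : ZMod 2) : ℝ := if x = 0 then 1 else -1

@[simp] lemma bitSign_zero : bitSign 0 = 1 := by simp [bitSign]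

@[simp] lemma bitSign_one : bitSign 1 = -1 := by simp [bitSign]

lemma zmod_two_cases (x : ZMod 2) : x = 0 ∨ x = 1 := by
  revert x; decide

lemma sum_zmod_two {M : Type*} [AddCommMonoid M] (f : ZMod 2 → M) : ∑ x, f x = f 0 + f 1 :=
  Fin.sum_univ_two f

lemma bitSign_add (x y : ZMod 2) : bitSign (x + y) = bitSign x * bitSign y := by
  have h : (1 : ZMod 2) + 1 = 0 := by decide
  rcases zmod_two_cases x with rfl | rfl <;> rcases zmod_two_cases y with rfl | rfl <;> simp [h]

lemma bitSign_eq (x : ZMod 2) : bitSign x = 1 ∨ bitSign x = -1 := by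
  rcases zmod_two_cases x with rfl | rfl <;> simp

lemma bitSign_mul_mem (x : ZMod 2) (d : SoftBit) : bitSign x * d ∈ Set.Icc (-1 : ℝ) 1 := by
  obtain ⟨h1, h2⟩ := d.2
  rcases bitSign_eq x with h | h <;> rw [h] <;> constructor <;> linarith

lemma mul_mem_softBit {x y : ℝ} (hx : x ∈ Set.Icc (-1 : ℝ) 1) (hy : y ∈ Set.Icc (-1 : ℝ) 1) :
    x * y ∈ Set.Icc (-1 : ℝ) 1 := by
  obtain ⟨h1, h2⟩ := hx
  obtain ⟨h3, h4⟩ := hy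
  constructor <;> nlinarith

lemma add_div_mem_softBit {x y : ℝ} (hx : x ∈ Set.Icc (-1 : ℝ) 1) (hy : y ∈ Set.Icc (-1 : ℝ) 1) :
    (x + y) / (1 + x * y) ∈ Set.Icc (-1 : ℝ) 1 := by
  have h := mul_mem_softBit hx hy
  obtain ⟨h1, h2⟩ := hx
  obtain ⟨h3, h4⟩ := hy
  rcases eq_or_lt_of_le (by linarith [h.1] : 0 ≤ 1 + x * y) with h0 | h0
  · rw [← h0]; simp
  · constructor
    · rw [le_div_iff₀ h0]; nlinarith
    · rw [div_le_one h0]; nlinarith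

/-- The probability of the input bit `x` given the soft bit `d`. -/
noncomputable def posterior (d : SoftBit) (x : ZMod 2) : ℝ≥0 :=
  ⟨(1 + bitSign x * d) / 2, by linarith [(bitSign_mul_mem x d).1]⟩

lemma coe_posterior (d : SoftBit) (x : ZMod 2) :
    (posterior d x : ℝ) = (1 + bitSign x * d) / 2 := rfl

lemma measurable_posterior (x : ZMod 2) : Measurable fun d => posterior d x := by
  unfold posterior
  fun_prop

lemma posterior_le_one (d : SoftBit) (x : ZMod 2) : posterior d x ≤ 1 := by
  rw [← NNReal.coe_le_coe, coe_posterior]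
  have := (bitSign_mul_mem x d).2
  push_cast
  linarith

lemma posterior_zero_add_one (d : SoftBit) : posterior d 0 + posterior d 1 = 1 := by
  apply NNReal.eq
  push_cast
  simp only [coe_posterior, bitSign_zero, bitSign_one]
  ring

/-- The soft bit of `a` when `a + b` (if `s`) or `a` (otherwise) is observed with soft bit `d₁` and
the uniform bit `b` with soft bit `d₂`. -/
def checkBit (s : Bool) (d₁ d₂ : SoftBit) : SoftBit :=
  if s then ⟨d₁ * d₂, mul_mem_softBit d₁.2 d₂.2⟩ else d₁

/-- The soft bit of `b` when, in the situation of `checkBit`, the bit `a` is known. -/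
noncomputable def varBit (s : Bool) (a : ZMod 2) (d₁ d₂ : SoftBit) : SoftBit :=
  if s then ⟨(bitSign a * d₁ + d₂) / (1 + bitSign a * d₁ * d₂),
    add_div_mem_softBit (bitSign_mul_mem a d₁) d₂.2⟩ else d₂

lemma measurable_checkBit (s : Bool) : Measurable fun p : SoftBit × SoftBit => checkBit s p.1 p.2 := by
  cases s
  · simpa [checkBit] using measurable_fst
  · simp only [checkBit, if_true]
    fun_prop

lemma measurable_varBit (s : Bool) (a : ZMod 2) :
    Measurable fun p : SoftBit × SoftBit => varBit s a p.1 p.2 := by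
  cases s
  · simpa [varBit] using measurable_snd
  · simp only [varBit, if_true]
    fun_prop

/-- Bayes' rule: the joint posterior of (a, b) is the posterior of a times the conditional posterior
of b given a. Every later identity about a layer comes from this factorization. -/
lemma posterior_mul_posterior (s : Bool) (a b : ZMod 2) (d₁ d₂ : SoftBit) :
    posterior d₁ (if s then a + b else a) * posterior d₂ b =
      posterior (checkBit s d₁ d₂) a * posterior (varBit s a d₁ d₂) b := by
  apply NNReal.eq
  cases s
  · simp [checkBit, varBit]
  · push_cast
    simp only [coe_posterior, checkBit, varBit, if_true, bitSign_add]
    have hx := bitSign_mul_mem a d₁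
    set x := bitSign a * (d₁ : ℝ) with hxd
    have hb : bitSign b * bitSign b = 1 := by rcases bitSign_eq b with h | h <;> rw [h] <;> norm_num
    have e1 : bitSign a * bitSign b * (d₁ : ℝ) = bitSign b * x := by rw [hxd]; ring
    have e2 : bitSign a * ((d₁ : ℝ) * d₂) = x * d₂ := by rw [hxd]; ring
    rw [e1, e2]
    obtain ⟨h1, h2⟩ := hx
    obtain ⟨h3, h4⟩ := d₂.2
    -- If the known bit has posterior probability zero, the quotient in `varBit` takes the default
    -- value 0; its value is irrelevant, because then both sides vanish.
    rcases eq_or_ne (1 + x * d₂) 0 with h0 | h0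
    · rw [h0]
      have : (1 + bitSign b * x) * (1 + bitSign b * (d₂ : ℝ)) = 0 := by
        have e : (1 + bitSign b * x) * (1 + bitSign b * (d₂ : ℝ)) =
          bitSign b * (x + d₂) := by linear_combination x * d₂ * hb + h0
        have h5 : x + d₂ = 0 := by nlinarith
        rw [e, h5, mul_zero]
      linear_combination this / 4
    · field_simp
      linear_combination x * d₂ * hb

lemma sum_posterior_mul_posterior (s : Bool) (a : ZMod 2) (d₁ d₂ : SoftBit) :
    ∑ b, posterior d₁ (if s then a + b else a) * posterior d₂ b =
      posterior (checkBit s d₁ d₂) a := by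
  simp_rw [posterior_mul_posterior, ← Finset.mul_sum, sum_zmod_two, posterior_zero_add_one, mul_one]

/-! ### Channels as laws of soft bits, and the two channels made by a layer. -/

/-- A binary-input channel, up to equivalence: the law of its soft bit for uniform input. -/
abbrev SoftLaw := ProbabilityMeasure SoftBit

/-- The worse channel `a ↦ (output₁, output₂)` of a partially polarizing layer. -/
noncomputable def checkLaw (s : Bool) (μ ν : SoftLaw) : SoftLaw :=
  ⟨((μ : Measure SoftBit).prod ν).map fun p => checkBit s p.1 p.2,
    Measure.isProbabilityMeasure_map (measurable_checkBit s).aemeasurable⟩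

/-- The unnormalized law of the soft bit of `b`, on the event that the known bit is `a`. -/
noncomputable def varPart (s : Bool) (μ ν : SoftLaw) (a : ZMod 2) : Measure SoftBit :=
  (((μ : Measure SoftBit).prod ν).withDensity
    fun p => (posterior (checkBit s p.1 p.2) a : ℝ≥0∞)).map fun p => varBit s a p.1 p.2

lemma measurable_posterior_checkBit (s : Bool) (a : ZMod 2) :
    Measurable fun p : SoftBit × SoftBit => posterior (checkBit s p.1 p.2) a :=
  (measurable_posterior a).comp (measurable_checkBit s)

lemma lintegral_varPart (s : Bool) (μ ν : SoftLaw) (a : ZMod 2) {f : SoftBit → ℝ≥0∞}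
    (hf : Measurable f) :
    ∫⁻ d, f d ∂(varPart s μ ν a) = ∫⁻ p, (posterior (checkBit s p.1 p.2) a : ℝ≥0∞) *
      f (varBit s a p.1 p.2) ∂((μ : Measure SoftBit).prod ν) := by
  rw [varPart, lintegral_map hf (measurable_varBit s a), lintegral_withDensity_eq_lintegral_mul]
  · rfl
  · exact (measurable_posterior_checkBit s a).coe_nnreal_ennreal
  · exact hf.comp (measurable_varBit s a)

lemma isProbabilityMeasure_sum_varPart (s : Bool) (μ ν : SoftLaw) :
    IsProbabilityMeasure (∑ a, varPart s μ ν a) := by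
  constructor
  rw [← lintegral_one, lintegral_finsetSum_measure]
  simp_rw [lintegral_varPart s μ ν _ (measurable_const (a := (1 : ℝ≥0∞))), mul_one]
  rw [sum_zmod_two, ← lintegral_add_left (measurable_posterior_checkBit s 0).coe_nnreal_ennreal]
  simp_rw [← ENNReal.coe_add, posterior_zero_add_one]
  simp

/-- The better channel `b ↦ (output₁, output₂, a)` of a partially polarizing layer. -/
noncomputable def varLaw (s : Bool) (μ ν : SoftLaw) : SoftLaw :=
  ⟨∑ a, varPart s μ ν a, isProbabilityMeasure_sum_varPart s μ ν⟩

lemma coe_varLaw (s : Bool) (μ ν : SoftLaw) :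
    (varLaw s μ ν : Measure SoftBit) = ∑ a, varPart s μ ν a := rfl

lemma coe_checkLaw (s : Bool) (μ ν : SoftLaw) : (checkLaw s μ ν : Measure SoftBit) =
    ((μ : Measure SoftBit).prod ν).map fun p => checkBit s p.1 p.2 := rfl

/-- Bounded measurable functions are integrable. -/
lemma integrable_of_bound {Ω : Type*} [MeasurableSpace Ω] {P : Measure Ω} [IsFiniteMeasure P]
    {f : Ω → ℝ} (hf : Measurable f) {C : ℝ} (hC : ∀ x, |f x| ≤ C) : Integrable f P :=
  Integrable.of_bound hf.aestronglyMeasurable C (Eventually.of_forall hC)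

lemma integral_checkLaw (s : Bool) (μ ν : SoftLaw) {f : SoftBit → ℝ} (hf : Measurable f) :
    ∫ d, f d ∂(checkLaw s μ ν : Measure SoftBit) =
      ∫ p, f (checkBit s p.1 p.2) ∂((μ : Measure SoftBit).prod ν) := by
  rw [coe_checkLaw, integral_map (measurable_checkBit s).aemeasurable hf.aestronglyMeasurable]

lemma integrable_posterior_mul (s : Bool) (μ ν : SoftLaw) {f : SoftBit → ℝ} (hf : Measurable f)
    {C : ℝ} (hC : ∀ d, |f d| ≤ C) (a : ZMod 2) : Integrable (fun p : SoftBit × SoftBit =>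
      (posterior (checkBit s p.1 p.2) a : ℝ) * f (varBit s a p.1 p.2))
      ((μ : Measure SoftBit).prod ν) := by
  refine integrable_of_bound (C := C) ((measurable_posterior_checkBit s a).coe_nnreal_real.mul
    (hf.comp (measurable_varBit s a))) fun p => ?_
  rw [abs_mul, NNReal.abs_eq]
  have h1 : (posterior (checkBit s p.1 p.2) a : ℝ) ≤ 1 := posterior_le_one _ _
  calc _ ≤ 1 * C := mul_le_mul h1 (hC _) (abs_nonneg _) zero_le_one
    _ = C := one_mul C

/-- The known bit a is averaged out with its posterior weights, so integrals over the better channel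
become integrals over the two independent outputs. -/
lemma integral_varLaw (s : Bool) (μ ν : SoftLaw) {f : SoftBit → ℝ} (hf : Measurable f) {C : ℝ}
    (hC : ∀ d, |f d| ≤ C) :
    ∫ d, f d ∂(varLaw s μ ν : Measure SoftBit) =
      ∫ p, (posterior (checkBit s p.1 p.2) 0 * f (varBit s 0 p.1 p.2) +
        posterior (checkBit s p.1 p.2) 1 * f (varBit s 1 p.1 p.2))
        ∂((μ : Measure SoftBit).prod ν) := by
  have hfin (a : ZMod 2) : IsFiniteMeasure (varPart s μ ν a) := by
    have := isProbabilityMeasure_sum_varPart s μ ν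
    refine isFiniteMeasure_of_le (∑ a, varPart s μ ν a) ?_
    exact Finset.single_le_sum (f := varPart s μ ν) (fun _ _ => Measure.zero_le _)
      (Finset.mem_univ a)
  have hpart (a : ZMod 2) : ∫ d, f d ∂(varPart s μ ν a) =
      ∫ p, (posterior (checkBit s p.1 p.2) a : ℝ) * f (varBit s a p.1 p.2)
        ∂((μ : Measure SoftBit).prod ν) := by
    rw [varPart, integral_map (measurable_varBit s a).aemeasurable hf.aestronglyMeasurable,
      integral_withDensity_eq_integral_smul (measurable_posterior_checkBit s a)]
    rfl
  rw [coe_varLaw, integral_finsetSum_measure fun a _ => ?_]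
  · rw [sum_zmod_two, hpart, hpart, ← integral_add (integrable_posterior_mul s μ ν hf hC 0)
      (integrable_posterior_mul s μ ν hf hC 1)]
  · exact integrable_of_bound hf hC

/-! ### Pointwise inequalities for Bhattacharyya coefficient, squared soft bit and entropy. -/

/-- Half the Bhattacharyya coefficient of the posterior distribution. -/
noncomputable def bhattBit (d : SoftBit) : ℝ≥0 := NNReal.sqrt (posterior d 0 * posterior d 1)

/-- The entropy, in bits, of the posterior distribution. -/
noncomputable def entropyBit (d : SoftBit) : ℝ := Real.binEntropy ((1 + d) / 2) / Real.log 2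

lemma measurable_bhattBit : Measurable bhattBit :=
  NNReal.continuous_sqrt.measurable.comp ((measurable_posterior 0).mul (measurable_posterior 1))

lemma measurable_entropyBit : Measurable entropyBit := by
  unfold entropyBit
  exact (Real.binEntropy_continuous.measurable.comp (by fun_prop)).div_const _

lemma coe_bhattBit (d : SoftBit) : (bhattBit d : ℝ) = √(1 - (d : ℝ) ^ 2) / 2 := by
  have h : ((posterior d 0 * posterior d 1 : ℝ≥0) : ℝ) = (1 - (d : ℝ) ^ 2) / 2 ^ 2 := by
    push_cast
    simp only [coe_posterior, bitSign_zero, bitSign_one]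
    ring
  rw [bhattBit, Real.coe_sqrt, h, Real.sqrt_div' _ (by positivity), Real.sqrt_sq (by norm_num)]

lemma sq_le_one (d : SoftBit) : (d : ℝ) ^ 2 ≤ 1 := by
  obtain ⟨h1, h2⟩ := d.2
  nlinarith

lemma two_mul_bhattBit_sq (d : SoftBit) : (2 * bhattBit d : ℝ) ^ 2 = 1 - (d : ℝ) ^ 2 := by
  rw [coe_bhattBit, mul_div_cancel₀ _ two_ne_zero, Real.sq_sqrt (by linarith [sq_le_one d])]

lemma two_mul_bhattBit_le_one (d : SoftBit) : (2 * bhattBit d : ℝ) ≤ 1 := by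
  have h := two_mul_bhattBit_sq d
  have h0 : (0 : ℝ) ≤ 2 * bhattBit d := by positivity
  nlinarith [sq_nonneg (d : ℝ)]

/-- Take the geometric mean over b in `posterior_mul_posterior`: for fixed a, the bit a + b runs
through both values, so the left factors are the two posteriors of d₁ in some order. -/
lemma posterior_mul_bhattBit (a : ZMod 2) (d₁ d₂ : SoftBit) :
    posterior (checkBit true d₁ d₂) a * bhattBit (varBit true a d₁ d₂) =
      bhattBit d₁ * bhattBit d₂ := by
  have h0 := posterior_mul_posterior true a 0 d₁ d₂
  have h1 := posterior_mul_posterior true a 1 d₁ d₂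
  have e : ∀ x : ℝ≥0, x = NNReal.sqrt (x * x) := fun x => (NNReal.sqrt_mul_self x).symm
  rw [bhattBit, bhattBit, bhattBit, e (posterior (checkBit true d₁ d₂) a), ← NNReal.sqrt_mul,
    ← NNReal.sqrt_mul, mul_mul_mul_comm, ← h0, ← h1]
  have h2 : (1 : ZMod 2) + 1 = 0 := by decide
  rcases zmod_two_cases a with rfl | rfl
  · simp; ring_nf
  · simp [h2]; ring_nf

lemma two_mul_bhattBit_checkBit_le (d₁ d₂ : SoftBit) :
    (2 * bhattBit (checkBit true d₁ d₂) : ℝ) ≤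
      2 * bhattBit d₁ + 2 * bhattBit d₂ - 2 * bhattBit d₁ * (2 * bhattBit d₂) := by
  have h := two_mul_bhattBit_sq (checkBit true d₁ d₂)
  have h1 := two_mul_bhattBit_sq d₁
  have h2 := two_mul_bhattBit_sq d₂
  have l1 := two_mul_bhattBit_le_one d₁
  have l2 := two_mul_bhattBit_le_one d₂
  have n1 : (0 : ℝ) ≤ 2 * bhattBit d₁ := by positivity
  have n2 : (0 : ℝ) ≤ 2 * bhattBit d₂ := by positivity
  have e : ((checkBit true d₁ d₂ : SoftBit) : ℝ) = d₁ * d₂ := rfl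
  rw [e, mul_pow (d₁ : ℝ)] at h
  set x : ℝ := 2 * bhattBit d₁
  set y : ℝ := 2 * bhattBit d₂
  have hd1 : (d₁ : ℝ) ^ 2 = 1 - x ^ 2 := by linarith
  have hd2 : (d₂ : ℝ) ^ 2 = 1 - y ^ 2 := by linarith
  rw [hd1, hd2] at h
  refine le_of_sq_le_sq ?_ (by nlinarith)
  rw [h]
  -- The difference of the squares is (x + y - xy)² - (x² + y² - x²y²) = 2xy(1 - x)(1 - y).
  have : 0 ≤ x * y * ((1 - x) * (1 - y)) := by
    have := sub_nonneg.2 l1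
    have := sub_nonneg.2 l2
    positivity
  nlinarith

/-- With K = (1 - x²)(1 - y²) one has (x + y)² = (1 + xy)² - K, and K/(1 + xy) ≥ K(1 - xy). The
bound is chosen so that averaging over x = ±d₁ cancels the terms odd in xy. -/
lemma mul_div_sq_le {x y : ℝ} (hx : x ∈ Set.Icc (-1 : ℝ) 1) (hy : y ∈ Set.Icc (-1 : ℝ) 1) :
    (1 + x * y) * ((x + y) / (1 + x * y)) ^ 2 ≤
      (1 + x * y) - (1 - x ^ 2) * (1 - y ^ 2) * (1 - x * y) := by
  have h := mul_mem_softBit hx hy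
  have hK : 0 ≤ (1 - x ^ 2) * (1 - y ^ 2) := by
    obtain ⟨h1, h2⟩ := hx
    obtain ⟨h3, h4⟩ := hy
    exact mul_nonneg (by nlinarith) (by nlinarith)
  rcases eq_or_lt_of_le (by linarith [h.1] : 0 ≤ 1 + x * y) with h0 | h0
  · have hK0 : (1 - x ^ 2) * (1 - y ^ 2) = 0 := by nlinarith [sq_nonneg (x + y)]
    rw [← h0, hK0]; simp
  · have e : (1 + x * y) * ((x + y) / (1 + x * y)) ^ 2 = (x + y) ^ 2 / (1 + x * y) := by
      field_simp
    rw [e, div_le_iff₀ h0]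
    nlinarith [mul_nonneg hK (sq_nonneg (x * y))]

lemma posterior_mul_varBit_sq_le (d₁ d₂ : SoftBit) :
    (posterior (checkBit true d₁ d₂) 0 * (varBit true 0 d₁ d₂ : ℝ) ^ 2 +
      posterior (checkBit true d₁ d₂) 1 * (varBit true 1 d₁ d₂ : ℝ) ^ 2 : ℝ) ≤
      (d₁ : ℝ) ^ 2 + (d₂ : ℝ) ^ 2 - (d₁ : ℝ) ^ 2 * (d₂ : ℝ) ^ 2 := by
  have h0 := mul_div_sq_le (bitSign_mul_mem 0 d₁) d₂.2
  have h1 := mul_div_sq_le (bitSign_mul_mem 1 d₁) d₂.2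
  simp only [coe_posterior, checkBit, varBit, if_true]
  simp only [bitSign_zero, bitSign_one, one_mul, neg_mul] at h0 h1 ⊢
  nlinarith

lemma entropyBit_eq (d : SoftBit) : entropyBit d =
    (Real.negMulLog (posterior d 0) + Real.negMulLog (posterior d 1)) / Real.log 2 := by
  rw [entropyBit, Real.binEntropy_eq_negMulLog_add_negMulLog_one_sub]
  simp only [coe_posterior, bitSign_zero, bitSign_one]
  ring_nf

lemma entropyBit_nonneg (d : SoftBit) : 0 ≤ entropyBit d := by
  obtain ⟨h1, h2⟩ := d.2
  exact div_nonneg (Real.binEntropy_nonneg (by linarith) (by linarith)) (Real.log_nonneg one_le_two)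

lemma entropyBit_le_one (d : SoftBit) : entropyBit d ≤ 1 :=
  div_le_one_of_le₀ Real.binEntropy_le_log_two (Real.log_nonneg one_le_two)

/-- The chain rule: (a, b) and the pair sent over the channels determine each other and so have the
same entropy. It follows from applying -x log x to the factorization at the four values of (a, b).
-/
lemma entropyBit_conservation (s : Bool) (d₁ d₂ : SoftBit) :
    entropyBit (checkBit s d₁ d₂) +
      (posterior (checkBit s d₁ d₂) 0 * entropyBit (varBit s 0 d₁ d₂) +
        posterior (checkBit s d₁ d₂) 1 * entropyBit (varBit s 1 d₁ d₂)) =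
      entropyBit d₁ + entropyBit d₂ := by
  have hL (a b : ZMod 2) := congrArg (fun x : ℝ≥0 => Real.negMulLog (x : ℝ))
    (posterior_mul_posterior s a b d₁ d₂)
  simp only [NNReal.coe_mul, Real.negMulLog_mul] at hL
  have h00 := hL 0 0
  have h01 := hL 0 1
  have h10 := hL 1 0
  have h11 := hL 1 1
  have hsum (d : SoftBit) : (posterior d 1 : ℝ) = 1 - posterior d 0 := by
    have := congrArg NNReal.toReal (posterior_zero_add_one d)
    push_cast at this
    linarith
  simp only [entropyBit_eq]
  have h2 : (1 : ZMod 2) + 1 = 0 := by decide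
  have hlog : Real.log 2 ≠ 0 := (Real.log_pos one_lt_two).ne'
  field_simp
  cases s
  all_goals
    simp only [add_zero, zero_add, if_true, h2, hsum, Bool.false_eq_true, if_false] at h00 h01 h10 h11 ⊢
    linarith

/-- Apply log(2p) ≤ 2p - 1 to both posteriors p and average: the right sides give d². Dividing by
log 2 > 1/2 produces the factor 2. -/
lemma one_sub_entropyBit_le (d : SoftBit) : 1 - entropyBit d ≤ 2 * (d : ℝ) ^ 2 := by
  have key (x : ZMod 2) : (posterior d x : ℝ) * Real.log 2 - Real.negMulLog (posterior d x) ≤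
      posterior d x * (bitSign x * d) := by
    rcases eq_or_ne (posterior d x : ℝ) 0 with h | h
    · simp [h]
    · have h1 := Real.log_le_sub_one_of_pos (x := 2 * (posterior d x : ℝ)) (by positivity)
      rw [Real.log_mul two_ne_zero h] at h1
      have e : 2 * (posterior d x : ℝ) - 1 = bitSign x * d := by rw [coe_posterior]; ring
      rw [Real.negMulLog]
      nlinarith [(posterior d x).2, mul_le_mul_of_nonneg_left h1 (posterior d x).2]
  have h0 := key 0
  have h1 := key 1
  have hlog : 1 / 2 < Real.log 2 := by linarith [Real.log_two_gt_d9]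
  have hs : Real.log 2 * (1 - entropyBit d) ≤ (d : ℝ) ^ 2 := by
    rw [entropyBit_eq, mul_sub, mul_div_cancel₀ _ (by positivity)]
    have h2 : (posterior d 0 : ℝ) + posterior d 1 = 1 := by
      exact_mod_cast congrArg NNReal.toReal (posterior_zero_add_one d)
    have h3 : (posterior d 0 : ℝ) * (bitSign 0 * d) + posterior d 1 * (bitSign 1 * d) =
      (d : ℝ) ^ 2 := by
      simp only [coe_posterior, bitSign_zero, bitSign_one]; ring
    calc _ = ((posterior d 0 : ℝ) + posterior d 1) * Real.log 2 -
          (Real.negMulLog (posterior d 0) + Real.negMulLog (posterior d 1)) := by rw [h2]; ring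
      _ ≤ _ := by linarith
  nlinarith [entropyBit_le_one d]

/-! ### The three channel parameters Z, S, H under a layer. -/

/-- The Bhattacharyya parameter. -/
noncomputable def bhatt (μ : SoftLaw) : ℝ := ∫ d, 2 * (bhattBit d : ℝ) ∂(μ : Measure SoftBit)

/-- The second moment of the soft bit. -/
noncomputable def softPower (μ : SoftLaw) : ℝ := ∫ d, (d : ℝ) ^ 2 ∂(μ : Measure SoftBit)

/-- The conditional entropy, in bits, of a uniform input given the output. -/
noncomputable def condEntropy (μ : SoftLaw) : ℝ := ∫ d, entropyBit d ∂(μ : Measure SoftBit)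

lemma measurable_two_mul_bhattBit : Measurable fun d => 2 * (bhattBit d : ℝ) :=
  measurable_bhattBit.coe_nnreal_real.const_mul 2

lemma abs_two_mul_bhattBit_le (d : SoftBit) : |2 * (bhattBit d : ℝ)| ≤ 1 := by
  rw [abs_of_nonneg (by positivity)]
  exact two_mul_bhattBit_le_one d

lemma measurable_sq : Measurable fun d : SoftBit => (d : ℝ) ^ 2 := by fun_prop

lemma abs_sq_le_one (d : SoftBit) : |(d : ℝ) ^ 2| ≤ 1 := by
  rw [abs_of_nonneg (by positivity)]
  exact sq_le_one d

lemma abs_entropyBit_le_one (d : SoftBit) : |entropyBit d| ≤ 1 := by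
  rw [abs_of_nonneg (entropyBit_nonneg d)]
  exact entropyBit_le_one d

section Moments

variable {μ ν : SoftLaw} {f g : SoftBit → ℝ}

lemma integral_mem_Icc (hf : Measurable f) (h0 : ∀ d, 0 ≤ f d) (h1 : ∀ d, f d ≤ 1) :
    ∫ d, f d ∂(μ : Measure SoftBit) ∈ Set.Icc (0 : ℝ) 1 := by
  refine ⟨integral_nonneg h0, ?_⟩
  calc ∫ d, f d ∂(μ : Measure SoftBit) ≤ ∫ _, (1 : ℝ) ∂(μ : Measure SoftBit) :=
        integral_mono (integrable_of_bound (C := 1) hf fun d => by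
          rw [abs_of_nonneg (h0 d)]; exact h1 d) (integrable_const _) h1
    _ = 1 := by simp

lemma integrable_fst (hf : Measurable f) (h : ∀ d, |f d| ≤ 1) :
    Integrable (fun p : SoftBit × SoftBit => f p.1) ((μ : Measure SoftBit).prod ν) :=
  integrable_of_bound (hf.comp measurable_fst) fun p => h p.1

lemma integrable_snd (hf : Measurable f) (h : ∀ d, |f d| ≤ 1) :
    Integrable (fun p : SoftBit × SoftBit => f p.2) ((μ : Measure SoftBit).prod ν) :=
  integrable_of_bound (hf.comp measurable_snd) fun p => h p.2

lemma integrable_fst_mul_snd (hf : Measurable f) (h : ∀ d, |f d| ≤ 1) (hg : Measurable g)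
    (h' : ∀ d, |g d| ≤ 1) :
    Integrable (fun p : SoftBit × SoftBit => f p.1 * g p.2) ((μ : Measure SoftBit).prod ν) :=
  integrable_of_bound (C := 1) ((hf.comp measurable_fst).mul (hg.comp measurable_snd)) fun p => by
    rw [abs_mul]; exact mul_le_one₀ (h _) (abs_nonneg _) (h' _)

lemma integral_fst_add_snd (hf : Measurable f) (h : ∀ d, |f d| ≤ 1) (hg : Measurable g)
    (h' : ∀ d, |g d| ≤ 1) :
    ∫ p : SoftBit × SoftBit, (f p.1 + g p.2) ∂((μ : Measure SoftBit).prod ν) =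
      ∫ d, f d ∂(μ : Measure SoftBit) + ∫ d, g d ∂(ν : Measure SoftBit) := by
  rw [integral_add (integrable_fst hf h) (integrable_snd hg h'), integral_fun_fst,
    integral_fun_snd]
  simp

lemma integral_probabilistic_sum (hf : Measurable f) (h : ∀ d, |f d| ≤ 1) :
    ∫ p : SoftBit × SoftBit, (f p.1 + f p.2 - f p.1 * f p.2) ∂((μ : Measure SoftBit).prod ν) =
      ∫ d, f d ∂(μ : Measure SoftBit) + ∫ d, f d ∂(ν : Measure SoftBit) -
        (∫ d, f d ∂(μ : Measure SoftBit)) * ∫ d, f d ∂(ν : Measure SoftBit) := by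
  have hadd : Integrable (fun p : SoftBit × SoftBit => f p.1 + f p.2)
      ((μ : Measure SoftBit).prod ν) := (integrable_fst hf h).add (integrable_snd hf h)
  rw [integral_sub hadd (integrable_fst_mul_snd hf h hf h), integral_fst_add_snd hf h hf h, integral_prod_mul]

end Moments

lemma bhatt_mem (μ : SoftLaw) : bhatt μ ∈ Set.Icc (0 : ℝ) 1 :=
  integral_mem_Icc measurable_two_mul_bhattBit (fun _ => by positivity) two_mul_bhattBit_le_one

lemma softPower_mem (μ : SoftLaw) : softPower μ ∈ Set.Icc (0 : ℝ) 1 :=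
  integral_mem_Icc measurable_sq (fun _ => by positivity) sq_le_one

lemma condEntropy_mem (μ : SoftLaw) : condEntropy μ ∈ Set.Icc (0 : ℝ) 1 :=
  integral_mem_Icc measurable_entropyBit entropyBit_nonneg entropyBit_le_one

lemma bhatt_varLaw (μ ν : SoftLaw) : bhatt (varLaw true μ ν) = bhatt μ * bhatt ν := by
  rw [bhatt, integral_varLaw true μ ν measurable_two_mul_bhattBit abs_two_mul_bhattBit_le, bhatt,
    bhatt, ← integral_prod_mul]
  congr 1
  ext p
  have h (a : ZMod 2) : (posterior (checkBit true p.1 p.2) a : ℝ) *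
      bhattBit (varBit true a p.1 p.2) = bhattBit p.1 * bhattBit p.2 := by
    exact_mod_cast posterior_mul_bhattBit a p.1 p.2
  linear_combination 2 * h 0 + 2 * h 1

lemma bhatt_checkLaw_le (μ ν : SoftLaw) :
    bhatt (checkLaw true μ ν) ≤ bhatt μ + bhatt ν - bhatt μ * bhatt ν := by
  rw [bhatt, integral_checkLaw true μ ν measurable_two_mul_bhattBit, bhatt, bhatt,
    ← integral_probabilistic_sum measurable_two_mul_bhattBit abs_two_mul_bhattBit_le]
  refine integral_mono ?_ ?_ fun p => two_mul_bhattBit_checkBit_le p.1 p.2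
  · exact integrable_of_bound (measurable_two_mul_bhattBit.comp (measurable_checkBit true))
      fun p => abs_two_mul_bhattBit_le _
  · exact ((integrable_fst measurable_two_mul_bhattBit abs_two_mul_bhattBit_le).add
      (integrable_snd measurable_two_mul_bhattBit abs_two_mul_bhattBit_le)).sub
      (integrable_fst_mul_snd measurable_two_mul_bhattBit abs_two_mul_bhattBit_le
        measurable_two_mul_bhattBit abs_two_mul_bhattBit_le)

lemma softPower_checkLaw (μ ν : SoftLaw) :
    softPower (checkLaw true μ ν) = softPower μ * softPower ν := by
  rw [softPower, integral_checkLaw true μ ν measurable_sq, softPower, softPower,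
    ← integral_prod_mul]
  congr 1
  ext p
  simp [checkBit, mul_pow]

lemma softPower_varLaw_le (μ ν : SoftLaw) :
    softPower (varLaw true μ ν) ≤ softPower μ + softPower ν - softPower μ * softPower ν := by
  rw [softPower, integral_varLaw true μ ν measurable_sq abs_sq_le_one, softPower, softPower,
    ← integral_probabilistic_sum measurable_sq abs_sq_le_one]
  refine integral_mono ?_ ?_ fun p => posterior_mul_varBit_sq_le p.1 p.2
  · exact (integrable_posterior_mul true μ ν measurable_sq abs_sq_le_one 0).add
      (integrable_posterior_mul true μ ν measurable_sq abs_sq_le_one 1)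
  · exact ((integrable_fst measurable_sq abs_sq_le_one).add
      (integrable_snd measurable_sq abs_sq_le_one)).sub
      (integrable_fst_mul_snd measurable_sq abs_sq_le_one measurable_sq abs_sq_le_one)

lemma condEntropy_checkLaw_add_varLaw (s : Bool) (μ ν : SoftLaw) :
    condEntropy (checkLaw s μ ν) + condEntropy (varLaw s μ ν) =
      condEntropy μ + condEntropy ν := by
  rw [condEntropy, integral_checkLaw s μ ν measurable_entropyBit, condEntropy,
    integral_varLaw s μ ν measurable_entropyBit abs_entropyBit_le_one, condEntropy, condEntropy,
    ← integral_fst_add_snd measurable_entropyBit abs_entropyBit_le_one measurable_entropyBit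
      abs_entropyBit_le_one, ← integral_add]
  · congr 1
    ext p
    exact entropyBit_conservation s p.1 p.2
  · exact integrable_of_bound (measurable_entropyBit.comp (measurable_checkBit s))
      fun p => abs_entropyBit_le_one _
  · exact (integrable_posterior_mul s μ ν measurable_entropyBit abs_entropyBit_le_one 0).add
      (integrable_posterior_mul s μ ν measurable_entropyBit abs_entropyBit_le_one 1)

/-- The variance of 2 * `bhattBit` is nonnegative, and its square is 1 - d². This excludes channels
with both Z and S near 1, which makes the potential √(ZS) contract. -/
lemma bhatt_sq_le (μ : SoftLaw) : bhatt μ ^ 2 ≤ 1 - softPower μ := by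
  have hZ : Integrable (fun d => 2 * (bhattBit d : ℝ)) (μ : Measure SoftBit) :=
    integrable_of_bound measurable_two_mul_bhattBit abs_two_mul_bhattBit_le
  have hS : Integrable (fun d : SoftBit => (d : ℝ) ^ 2) (μ : Measure SoftBit) :=
    integrable_of_bound measurable_sq abs_sq_le_one
  have h : 0 ≤ ∫ d, (2 * (bhattBit d : ℝ) - bhatt μ) ^ 2 ∂(μ : Measure SoftBit) :=
    integral_nonneg fun d => sq_nonneg _
  have e : ∫ d, (2 * (bhattBit d : ℝ) - bhatt μ) ^ 2 ∂(μ : Measure SoftBit) =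
      ∫ d, (((1 + bhatt μ ^ 2) - (d : ℝ) ^ 2) - 2 * bhatt μ * (2 * (bhattBit d : ℝ)))
        ∂(μ : Measure SoftBit) := by
    congr 1
    ext d
    linear_combination two_mul_bhattBit_sq d
  have hsub : Integrable (fun d : SoftBit => 1 + bhatt μ ^ 2 - (d : ℝ) ^ 2)
      (μ : Measure SoftBit) := (integrable_const _).sub hS
  rw [e, integral_sub hsub (hZ.const_mul _),
    integral_sub (integrable_const _) hS, integral_const_mul] at h
  simp only [integral_const, probReal_univ, smul_eq_mul, one_mul] at h
  change 0 ≤ 1 + bhatt μ ^ 2 - softPower μ - 2 * bhatt μ * bhatt μ at h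
  linarith

lemma one_sub_condEntropy_le (μ : SoftLaw) : 1 - condEntropy μ ≤ 2 * softPower μ := by
  have hS : Integrable (fun d : SoftBit => (d : ℝ) ^ 2) (μ : Measure SoftBit) :=
    integrable_of_bound measurable_sq abs_sq_le_one
  have hH : Integrable entropyBit (μ : Measure SoftBit) :=
    integrable_of_bound measurable_entropyBit abs_entropyBit_le_one
  have h := integral_mono ((integrable_const (1 : ℝ)).sub hH) (hS.const_mul 2)
    one_sub_entropyBit_le
  simp only [Pi.sub_apply] at h
  rw [integral_sub (integrable_const _) hH, integral_const_mul] at h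
  simp only [integral_const, probReal_univ, smul_eq_mul, one_mul] at h
  exact h

/-! ### The recursion of the polar transform on families of channels. -/

/-- The channels seen by the first half of the input after the layer of the polar transform nearest
to the channels `c 0, c 1, …`. -/
noncomputable def checkFamily (c : ℕ → SoftLaw) (k : ℕ) : SoftLaw :=
  checkLaw true (c (2 * k)) (c (2 * k + 1))

/-- The channels seen by the second half of the input. -/
noncomputable def varFamily (c : ℕ → SoftLaw) (k : ℕ) : SoftLaw :=
  varLaw true (c (2 * k)) (c (2 * k + 1))

/-- The `i`-th bit-channel of the polar transform of length `2 ^ n` on the channels `c`. -/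
noncomputable def polarLaw : (n : ℕ) → (ℕ → SoftLaw) → ℕ → SoftLaw
  | 0, c, _ => c 0
  | n + 1, c, i => if i < 2 ^ n then polarLaw n (checkFamily c) i
      else polarLaw n (varFamily c) (i - 2 ^ n)

/-- The sum of a functional over the bit-channels of the polar transform. -/
noncomputable def polarSum (g : SoftLaw → ℝ) (n : ℕ) (c : ℕ → SoftLaw) : ℝ :=
  ∑ i ∈ Finset.range (2 ^ n), g (polarLaw n c i)

lemma polarSum_zero (g : SoftLaw → ℝ) (c : ℕ → SoftLaw) : polarSum g 0 c = g (c 0) := by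
  simp [polarSum, polarLaw]

lemma polarSum_succ (g : SoftLaw → ℝ) (n : ℕ) (c : ℕ → SoftLaw) :
    polarSum g (n + 1) c = polarSum g n (checkFamily c) + polarSum g n (varFamily c) := by
  rw [polarSum, pow_succ, mul_two, Finset.sum_range_add]
  congr 1
  · refine Finset.sum_congr rfl fun i hi => ?_
    rw [polarLaw, if_pos (Finset.mem_range.1 hi)]
  · refine Finset.sum_congr rfl fun i _ => ?_
    rw [polarLaw, if_neg (by omega), Nat.add_sub_cancel_left]

lemma polarSum_mono {g h : SoftLaw → ℝ} (hgh : ∀ μ, g μ ≤ h μ) (n : ℕ) (c : ℕ → SoftLaw) :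
    polarSum g n c ≤ polarSum h n c :=
  Finset.sum_le_sum fun _ _ => hgh _

lemma polarSum_add (g h : SoftLaw → ℝ) (n : ℕ) (c : ℕ → SoftLaw) :
    polarSum (fun μ => g μ + h μ) n c = polarSum g n c + polarSum h n c :=
  Finset.sum_add_distrib

lemma polarSum_const_mul (r : ℝ) (g : SoftLaw → ℝ) (n : ℕ) (c : ℕ → SoftLaw) :
    polarSum (fun μ => r * g μ) n c = r * polarSum g n c :=
  (Finset.mul_sum _ _ _).symm

lemma polarSum_const (r : ℝ) (n : ℕ) (c : ℕ → SoftLaw) :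
    polarSum (fun _ => r) n c = 2 ^ n * r := by
  simp [polarSum]

lemma polarSum_succ_const (g : SoftLaw → ℝ) (n : ℕ) (μ : SoftLaw) :
    polarSum g (n + 1) (fun _ => μ) = polarSum g n (fun _ => checkLaw true μ μ) +
      polarSum g n (fun _ => varLaw true μ μ) :=
  polarSum_succ g n _

/-- Identical channels stay identical within each branch, so the last n layers act afresh on each
channel synthesized by the k layers nearest to the physical channel. -/
lemma polarSum_add_const (g : SoftLaw → ℝ) (k n : ℕ) (μ : SoftLaw) :
    polarSum g (k + n) (fun _ => μ) =
      polarSum (fun ν => polarSum g n fun _ => ν) k (fun _ => μ) := by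
  induction k generalizing μ with
  | zero => rw [zero_add, polarSum_zero]
  | succ k ih => rw [add_right_comm, polarSum_succ_const, ih, ih, polarSum_succ_const]

lemma polarSum_condEntropy (n : ℕ) (μ : SoftLaw) :
    polarSum condEntropy n (fun _ => μ) = 2 ^ n * condEntropy μ := by
  induction n generalizing μ with
  | zero => rw [polarSum_zero, pow_zero, one_mul]
  | succ n ih =>
    rw [polarSum_succ_const, ih, ih, ← mul_add, condEntropy_checkLaw_add_varLaw]
    ring

/-! ### Polarization through the contraction of √(ZS). -/

/-- A potential that vanishes exactly for perfect and for useless channels. -/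
noncomputable def unpolarized (μ : SoftLaw) : ℝ := √(bhatt μ * softPower μ)

/-- Square the sum: the two radicands add up to 2 - 2(1 - z)(1 - s) ≤ 2, so it is enough to keep
their product away from 1. The result is 2 + 2 · 0.95 = 3.9 < 1.98². -/
lemma sqrt_add_sqrt_le {z s : ℝ} (hz : z ∈ Set.Icc (0 : ℝ) 1) (hs : s ∈ Set.Icc (0 : ℝ) 1)
    (h : z ^ 2 ≤ 1 - s) : √(s * (2 - z)) + √(z * (2 - s)) ≤ 2 * (99 / 100) := by
  obtain ⟨hz0, hz1⟩ := hz
  obtain ⟨hs0, hs1⟩ := hs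
  have hA : 0 ≤ s * (2 - z) := mul_nonneg hs0 (by linarith)
  have hB : 0 ≤ z * (2 - s) := mul_nonneg hz0 (by linarith)
  have h1 : z * (2 - z) ≤ 1 := by nlinarith [sq_nonneg (1 - z)]
  have h2 : s * (2 - s) ≤ 1 := by nlinarith [sq_nonneg (1 - s)]
  have h3 : s * (2 - s) ≤ 1 - z ^ 4 := by
    nlinarith [mul_nonneg (sub_nonneg.2 h) (by nlinarith [sq_nonneg z] : 0 ≤ 1 - s + z ^ 2)]
  have hn1 : 0 ≤ z * (2 - z) := mul_nonneg hz0 (by linarith)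
  have hn2 : 0 ≤ s * (2 - s) := mul_nonneg hs0 (by linarith)
  have hAB : s * (2 - z) * (z * (2 - s)) ≤ 9 / 10 := by
    have e : s * (2 - z) * (z * (2 - s)) = z * (2 - z) * (s * (2 - s)) := by ring
    rw [e]
    -- The product is z(2 - z) · s(2 - s). Small z bounds the first factor away from 1; large z
    -- forces s ≤ 1 - z² and thereby bounds the second.
    rcases le_total z (6 / 10) with hz6 | hz6
    · have : z * (2 - z) ≤ 84 / 100 := by nlinarith
      nlinarith
    · have hz2 : (36 / 100 : ℝ) ≤ z ^ 2 := by nlinarith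
      have hz4 : (1296 / 10000 : ℝ) ≤ z ^ 4 := by nlinarith
      nlinarith
  have hsq : √(s * (2 - z)) * √(z * (2 - s)) ≤ 95 / 100 := by
    rw [← Real.sqrt_mul hA]
    exact (Real.sqrt_le_left (by norm_num)).2 (hAB.trans (by norm_num))
  refine le_of_sq_le_sq ?_ (by norm_num)
  have e1 := Real.sq_sqrt hA
  have e2 := Real.sq_sqrt hB
  nlinarith [mul_nonneg (sub_nonneg.2 hz1) (sub_nonneg.2 hs1)]

/-- The worse channel has ZS multiplied by at most S(2 - Z), the better one by at most Z(2 - S);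
`sqrt_add_sqrt_le` bounds the sum of the roots of these factors. -/
lemma unpolarized_checkLaw_add_varLaw_le (μ : SoftLaw) :
    unpolarized (checkLaw true μ μ) + unpolarized (varLaw true μ μ) ≤
      2 * (99 / 100) * unpolarized μ := by
  have hz := bhatt_mem μ
  have hs := softPower_mem μ
  have hzs : 0 ≤ bhatt μ * softPower μ := mul_nonneg hz.1 hs.1
  have h := sqrt_add_sqrt_le hz hs (bhatt_sq_le μ)
  have h1 : unpolarized (checkLaw true μ μ) ≤
      √(bhatt μ * softPower μ) * √(softPower μ * (2 - bhatt μ)) := by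
    rw [← Real.sqrt_mul hzs]
    refine Real.sqrt_le_sqrt ?_
    rw [softPower_checkLaw]
    calc _ ≤ (bhatt μ + bhatt μ - bhatt μ * bhatt μ) * (softPower μ * softPower μ) :=
          mul_le_mul_of_nonneg_right (bhatt_checkLaw_le μ μ) (mul_self_nonneg _)
      _ = _ := by ring
  have h2 : unpolarized (varLaw true μ μ) ≤
      √(bhatt μ * softPower μ) * √(bhatt μ * (2 - softPower μ)) := by
    rw [← Real.sqrt_mul hzs]
    refine Real.sqrt_le_sqrt ?_
    rw [bhatt_varLaw]
    calc _ ≤ bhatt μ * bhatt μ * (softPower μ + softPower μ - softPower μ * softPower μ) :=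
          mul_le_mul_of_nonneg_left (softPower_varLaw_le μ μ) (mul_self_nonneg _)
      _ = _ := by ring
  calc _ ≤ √(bhatt μ * softPower μ) *
        (√(softPower μ * (2 - bhatt μ)) + √(bhatt μ * (2 - softPower μ))) := by
        rw [mul_add]; exact add_le_add h1 h2
    _ ≤ √(bhatt μ * softPower μ) * (2 * (99 / 100)) :=
        mul_le_mul_of_nonneg_left h (Real.sqrt_nonneg _)
    _ = _ := by rw [unpolarized]; ring

lemma unpolarized_le_one (μ : SoftLaw) : unpolarized μ ≤ 1 :=
  Real.sqrt_le_one.2 (mul_le_one₀ (bhatt_mem μ).2 (softPower_mem μ).1 (softPower_mem μ).2)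

lemma polarSum_unpolarized_le (n : ℕ) (μ : SoftLaw) :
    polarSum unpolarized n (fun _ => μ) ≤ (2 * (99 / 100)) ^ n * unpolarized μ := by
  induction n generalizing μ with
  | zero => rw [polarSum_zero, pow_zero, one_mul]
  | succ n ih =>
    rw [polarSum_succ_const]
    calc _ ≤ (2 * (99 / 100) : ℝ) ^ n *
          (unpolarized (checkLaw true μ μ) + unpolarized (varLaw true μ μ)) := by
          rw [mul_add]; exact add_le_add (ih _) (ih _)
      _ ≤ (2 * (99 / 100) : ℝ) ^ n * (2 * (99 / 100) * unpolarized μ) :=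
          mul_le_mul_of_nonneg_left (unpolarized_checkLaw_add_varLaw_le μ) (by positivity)
      _ = _ := by ring

/-! ### Counting the unreliable bit-channels. -/

open Classical in
/-- The indicator of the channels with Bhattacharyya parameter above `t`. -/
noncomputable def unreliable (t : ℝ) (μ : SoftLaw) : ℝ := if t < bhatt μ then 1 else 0

lemma unreliable_le_one (t : ℝ) (μ : SoftLaw) : unreliable t μ ≤ 1 := by
  unfold unreliable; split_ifs <;> norm_num

lemma unreliable_nonneg (t : ℝ) (μ : SoftLaw) : 0 ≤ unreliable t μ := by
  unfold unreliable; split_ifs <;> norm_num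

lemma polarSum_unreliable_le_pow (t : ℝ) (n : ℕ) (c : ℕ → SoftLaw) :
    polarSum (unreliable t) n c ≤ 2 ^ n := by
  simpa [polarSum_const] using polarSum_mono (unreliable_le_one t) n c

/-- The fourth root. -/
noncomputable def fourthRoot (x : ℝ) : ℝ := √√x

lemma fourthRoot_mul {x : ℝ} (hx : 0 ≤ x) (y : ℝ) :
    fourthRoot (x * y) = fourthRoot x * fourthRoot y := by
  rw [fourthRoot, Real.sqrt_mul hx, Real.sqrt_mul (Real.sqrt_nonneg x)]; rfl

lemma fourthRoot_mono {x y : ℝ} (h : x ≤ y) : fourthRoot x ≤ fourthRoot y :=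
  Real.sqrt_le_sqrt (Real.sqrt_le_sqrt h)

lemma fourthRoot_nonneg (x : ℝ) : 0 ≤ fourthRoot x := Real.sqrt_nonneg _

lemma fourthRoot_pow_four {x : ℝ} (hx : 0 ≤ x) : fourthRoot (x ^ 4) = x := by
  rw [fourthRoot, show x ^ 4 = (x ^ 2) ^ 2 by ring, Real.sqrt_sq (by positivity), Real.sqrt_sq hx]

lemma fourthRoot_le {x y : ℝ} (hy : 0 ≤ y) (h : x ≤ y ^ 4) : fourthRoot x ≤ y :=
  (fourthRoot_mono h).trans_eq (fourthRoot_pow_four hy)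

lemma one_le_fourthRoot {x : ℝ} (h : 1 ≤ x) : 1 ≤ fourthRoot x := by
  simpa [fourthRoot] using fourthRoot_mono h

/-- The induction bounds the count by a potential. The linear term makes the claim trivial once Z ≥
10^(-4), and its sum over a layer is preserved. For smaller Z, the fourth root grows by at most 1.19
on one side and shrinks to at most 1/10 on the other, which averages to 0.645. A power Z^α gives an
average factor near 2^(α - 1), to be played against t^(-α) = 4^(αn) up to a constant; α = 1/4 lies
below the critical value 1/3. -/
lemma polarSum_unreliable_le {t : ℝ} (ht : 0 < t) (n : ℕ) (μ : SoftLaw) :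
    polarSum (unreliable t) n (fun _ => μ) ≤
      2 ^ n * (10 ^ 4 * bhatt μ + (645 / 1000) ^ n * fourthRoot (bhatt μ / t)) := by
  induction n generalizing μ with
  | zero =>
    rw [polarSum_zero, pow_zero, pow_zero, one_mul, one_mul]
    have h0 := (bhatt_mem μ).1
    unfold unreliable
    split_ifs with h
    · have := one_le_fourthRoot ((one_le_div ht).2 h.le)
      linarith
    · have := fourthRoot_nonneg (bhatt μ / t)
      positivity
  | succ n ih =>
    have hz := bhatt_mem μ
    have hq := fourthRoot_nonneg (bhatt μ / t)
    rcases le_total (1 / 10 ^ 4) (bhatt μ) with h | h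
    · refine (polarSum_unreliable_le_pow t _ _).trans (le_mul_of_one_le_right (by positivity) ?_)
      have : (0 : ℝ) ≤ (645 / 1000) ^ (n + 1) * fourthRoot (bhatt μ / t) := by positivity
      linarith
    · rw [polarSum_succ_const]
      have h1 := bhatt_checkLaw_le μ μ
      have h2 := bhatt_varLaw μ μ
      -- The constant satisfies 1.19⁴ ≥ 2, which covers Z⁻ ≤ 2Z; in the next bound Z⁺ = Z² ≤ 10^(-4)
      -- Z.
      have q1 : fourthRoot (bhatt (checkLaw true μ μ) / t) ≤
          119 / 100 * fourthRoot (bhatt μ / t) := by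
        calc _ ≤ fourthRoot (2 * (bhatt μ / t)) := by
              refine fourthRoot_mono ?_
              rw [← mul_div_assoc]
              exact div_le_div_of_nonneg_right (by nlinarith) ht.le
          _ = fourthRoot 2 * fourthRoot (bhatt μ / t) := fourthRoot_mul zero_le_two _
          _ ≤ _ := mul_le_mul_of_nonneg_right (fourthRoot_le (by norm_num) (by norm_num)) hq
      have q2 : fourthRoot (bhatt (varLaw true μ μ) / t) ≤
          1 / 10 * fourthRoot (bhatt μ / t) := by
        rw [h2, mul_div_assoc, fourthRoot_mul hz.1]
        exact mul_le_mul_of_nonneg_right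
          (fourthRoot_le (by norm_num) (h.trans (by norm_num))) hq
      calc _ ≤ 2 ^ n * (10 ^ 4 * (bhatt (checkLaw true μ μ) + bhatt (varLaw true μ μ)) +
            (645 / 1000) ^ n * (fourthRoot (bhatt (checkLaw true μ μ) / t) +
              fourthRoot (bhatt (varLaw true μ μ) / t))) := by
            refine (add_le_add (ih _) (ih _)).trans_eq (by ring)
        _ ≤ 2 ^ n * (10 ^ 4 * (2 * bhatt μ) +
            (645 / 1000) ^ n * (2 * (645 / 1000) * fourthRoot (bhatt μ / t))) := by
            gcongr <;> linarith
        _ = _ := by ring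

/-- If S ≤ ε, the entropy is at least 1 - 2ε. If S ≥ ε and Z > ζ, the potential √(ZS) is at least
√(ζε). -/
lemma unreliable_le {ζ ε : ℝ} (hζ : 0 < ζ) (hε : 0 < ε) (μ : SoftLaw) :
    unreliable ζ μ ≤ condEntropy μ + 1 / √(ζ * ε) * unpolarized μ + 2 * ε := by
  have hH := condEntropy_mem μ
  have hu : 0 ≤ 1 / √(ζ * ε) * unpolarized μ :=
    mul_nonneg (by positivity) (Real.sqrt_nonneg _)
  unfold unreliable
  split_ifs with h
  · rcases le_total (softPower μ) ε with hs | hs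
    · linarith [one_sub_condEntropy_le μ]
    · have : 1 ≤ 1 / √(ζ * ε) * unpolarized μ := by
        rw [one_div, inv_mul_eq_div, one_le_div (by positivity)]
        exact Real.sqrt_le_sqrt (mul_le_mul h.le hs hε.le (bhatt_mem μ).1)
      linarith [hH.1]
  · linarith [hH.1]

/-- Two stages: a fixed number k of layers polarizes, and the remaining n layers make the channels
with Z ≤ ζ reliable. Channels still above ζ after the first stage are given up entirely; their
number is controlled by entropy and potential. -/
lemma eventually_polarSum_unreliable_const (μ : SoftLaw) {ε C : ℝ} (hε : 0 < ε) (hC : 0 < C) :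
    ∀ᶠ n in atTop, polarSum (unreliable (C / 4 ^ n)) n (fun _ => μ) ≤
      2 ^ n * (condEntropy μ + ε) := by
  -- Chosen so that the linear term 10⁴ Z of `polarSum_unreliable_le` is at most ε/4 below ζ.
  set ζ := ε / (4 * 10 ^ 4) with hζd
  have hζ : 0 < ζ := by positivity
  set K := 1 / √(ζ * (ε / 8)) with hK
  have hK0 : 0 < K := by positivity
  obtain ⟨k, hk⟩ : ∃ k : ℕ, K * (99 / 100 : ℝ) ^ k ≤ ε / 4 := by
    obtain ⟨k, hk⟩ := exists_pow_lt_of_lt_one (by positivity : 0 < ε / 4 / K)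
      (by norm_num : (99 / 100 : ℝ) < 1)
    exact ⟨k, by rw [mul_comm]; exact ((lt_div_iff₀ hK0).1 hk).le⟩
  -- Here 0.915 exceeds 0.645 · 1.415, where 1.415⁴ ≥ 4: the decay of the fourth-root term beats the
  -- shrinking threshold.
  have hlim : Tendsto (fun n : ℕ => fourthRoot (4 ^ k / C) * (915 / 1000 : ℝ) ^ n) atTop (𝓝 0) := by
    simpa using (tendsto_pow_atTop_nhds_zero_of_lt_one (by norm_num)
      (by norm_num : (915 / 1000 : ℝ) < 1)).const_mul (fourthRoot (4 ^ k / C))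
  obtain ⟨n₀, hn₀⟩ := eventually_atTop.1 (hlim.eventually (ge_mem_nhds (by positivity : 0 < ε / 4)))
  refine eventually_atTop.2 ⟨k + n₀, fun l hl => ?_⟩
  obtain ⟨n, rfl⟩ := Nat.exists_eq_add_of_le (le_of_add_le_left hl)
  have hn := hn₀ n (by omega)
  have ht : 0 < C / 4 ^ (k + n) := by positivity
  have hroot (ν : SoftLaw) : (645 / 1000 : ℝ) ^ n * fourthRoot (bhatt ν / (C / 4 ^ (k + n))) ≤
      ε / 4 := by
    refine le_trans ?_ hn
    have e : bhatt ν / (C / 4 ^ (k + n)) = 4 ^ k / C * (4 ^ n * bhatt ν) := by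
      rw [pow_add]; field_simp
    rw [e, fourthRoot_mul (by positivity)]
    have h4 : fourthRoot (4 ^ n * bhatt ν) ≤ (1415 / 1000) ^ n := by
      refine fourthRoot_le (by positivity) ?_
      calc (4 : ℝ) ^ n * bhatt ν ≤ 4 ^ n * 1 :=
            mul_le_mul_of_nonneg_left (bhatt_mem ν).2 (by positivity)
        _ = 4 ^ n := mul_one _
        _ ≤ ((1415 / 1000 : ℝ) ^ 4) ^ n := by
            gcongr; norm_num
        _ = _ := by rw [← pow_mul, ← pow_mul, mul_comm]
    calc _ ≤ (645 / 1000 : ℝ) ^ n * (fourthRoot (4 ^ k / C) * (1415 / 1000) ^ n) := by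
          gcongr; exact fourthRoot_nonneg _
      _ = fourthRoot (4 ^ k / C) * (645 / 1000 * (1415 / 1000)) ^ n := by rw [mul_pow]; ring
      _ ≤ _ := by
          refine mul_le_mul_of_nonneg_left ?_ (fourthRoot_nonneg _)
          gcongr; norm_num
  have hpt (ν : SoftLaw) : polarSum (unreliable (C / 4 ^ (k + n))) n (fun _ => ν) ≤
      2 ^ n * (condEntropy ν + K * unpolarized ν + 3 * ε / 4) := by
    have hu := unreliable_le hζ (by positivity : 0 < ε / 8) ν
    rcases le_or_gt (bhatt ν) ζ with hν | hν
    · refine (polarSum_unreliable_le ht n ν).trans (mul_le_mul_of_nonneg_left ?_ (by positivity))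
      have h1 : 10 ^ 4 * bhatt ν ≤ ε / 4 := by
        calc 10 ^ 4 * bhatt ν ≤ 10 ^ 4 * ζ := by linarith
          _ = ε / 4 := by rw [hζd]; field_simp
      have h2 : 0 ≤ K * unpolarized ν := mul_nonneg hK0.le (Real.sqrt_nonneg _)
      linarith [hroot ν, (condEntropy_mem ν).1]
    · refine (polarSum_unreliable_le_pow _ n _).trans (le_mul_of_one_le_right (by positivity) ?_)
      rw [unreliable, if_pos hν] at hu
      linarith
  have hmid : K * polarSum unpolarized k (fun _ => μ) ≤ 2 ^ k * (ε / 4) := by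
    calc K * polarSum unpolarized k (fun _ => μ) ≤ K * ((2 * (99 / 100)) ^ k * 1) := by
          gcongr
          exact (polarSum_unpolarized_le k μ).trans
            (mul_le_mul_of_nonneg_left (unpolarized_le_one μ) (by positivity))
      _ = 2 ^ k * (K * (99 / 100) ^ k) := by rw [mul_pow]; ring
      _ ≤ _ := by gcongr
  rw [polarSum_add_const]
  calc _ ≤ polarSum (fun ν => 2 ^ n * (condEntropy ν + K * unpolarized ν + 3 * ε / 4)) k
        (fun _ => μ) := polarSum_mono hpt k _
    _ = 2 ^ n * (2 ^ k * condEntropy μ + K * polarSum unpolarized k (fun _ => μ) +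
        2 ^ k * (3 * ε / 4)) := by
      rw [polarSum_const_mul, polarSum_add, polarSum_add, polarSum_const_mul, polarSum_const,
        polarSum_condEntropy]
    _ ≤ 2 ^ n * (2 ^ k * condEntropy μ + 2 ^ k * (ε / 4) + 2 ^ k * (3 * ε / 4)) := by
      exact mul_le_mul_of_nonneg_left (by linarith) (by positivity)
    _ = _ := by rw [pow_add]; ring

/-! ### Periodic families of channels. -/

lemma sum_range_two_mul {M : Type*} [AddCommMonoid M] (f : ℕ → M) (n : ℕ) :
    ∑ k ∈ Finset.range (2 * n), f k =
      ∑ k ∈ Finset.range n, f (2 * k) + ∑ k ∈ Finset.range n, f (2 * k + 1) := by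
  induction n with
  | zero => simp
  | succ n ih =>
    rw [mul_add, mul_one, Finset.sum_range_succ, Finset.sum_range_succ, ih,
      Finset.sum_range_succ, Finset.sum_range_succ]
    abel

/-- One layer combines neighbours, so a family of period 2^(m+1) yields two of period 2^m with the
same total entropy. Since one layer is used up, the threshold becomes (C/4)/4^n; this is why C must
be arbitrary in the induction. -/
lemma eventually_polarSum_unreliable (m : ℕ) (c : ℕ → SoftLaw) (hc : ∀ k, c (k + 2 ^ m) = c k)
    {ε C : ℝ} (hε : 0 < ε) (hC : 0 < C) :
    ∀ᶠ n in atTop, polarSum (unreliable (C / 4 ^ n)) n c ≤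
      2 ^ n * ((∑ k ∈ Finset.range (2 ^ m), condEntropy (c k)) / 2 ^ m + ε) := by
  induction m generalizing c C with
  | zero =>
    have hconst : c = fun _ => c 0 := by
      funext k
      induction k with
      | zero => rfl
      | succ k ih => rw [← ih]; simpa using hc k
    rw [hconst]
    simpa using eventually_polarSum_unreliable_const (c 0) hε hC
  | succ m ih =>
    have hper (k j : ℕ) : c (2 * (k + 2 ^ m) + j) = c (2 * k + j) := by
      rw [← hc (2 * k + j)]; congr 1; ring
    have h1 := ih (checkFamily c) (fun k => by
      have h0 := hper k 0
      rw [add_zero, add_zero] at h0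
      rw [checkFamily, checkFamily, h0, hper k 1]) (by positivity : 0 < C / 4)
    have h2 := ih (varFamily c) (fun k => by
      have h0 := hper k 0
      rw [add_zero, add_zero] at h0
      rw [varFamily, varFamily, h0, hper k 1]) (by positivity : 0 < C / 4)
    obtain ⟨n₀, hn₀⟩ := eventually_atTop.1 (h1.and h2)
    refine eventually_atTop.2 ⟨n₀ + 1, fun l hl => ?_⟩
    obtain ⟨n, rfl⟩ : ∃ n, l = n + 1 := ⟨l - 1, by omega⟩
    obtain ⟨b1, b2⟩ := hn₀ n (by omega)
    have ht : C / 4 ^ (n + 1) = C / 4 / 4 ^ n := by rw [pow_succ]; field_simp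
    have hs : ∑ k ∈ Finset.range (2 ^ m), condEntropy (checkFamily c k) +
        ∑ k ∈ Finset.range (2 ^ m), condEntropy (varFamily c k) =
        ∑ k ∈ Finset.range (2 ^ (m + 1)), condEntropy (c k) := by
      rw [pow_succ, mul_comm (2 ^ m) 2, sum_range_two_mul, ← Finset.sum_add_distrib,
        ← Finset.sum_add_distrib]
      exact Finset.sum_congr rfl fun k _ => condEntropy_checkLaw_add_varLaw _ _ _
    rw [polarSum_succ, ht, ← hs]
    refine (add_le_add b1 b2).trans_eq ?_
    rw [pow_succ, pow_succ]
    field_simp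
    ring

/-! ### Product measures, and a layer applied to words of independent channels. -/

section PiMeasures

lemma lintegral_pi_prod {N : ℕ} {X : Type*} [MeasurableSpace X] (μ : Fin N → Measure X)
    [∀ k, SigmaFinite (μ k)] {f : Fin N → X → ℝ≥0∞} (hf : ∀ k, Measurable (f k)) :
    ∫⁻ x, ∏ k, f k (x k) ∂(Measure.pi μ) = ∏ k, ∫⁻ x, f k x ∂(μ k) := by
  induction N with
  | zero => simp
  | succ N ih =>
    have hm : Measurable fun x : Fin (N + 1) → X => ∏ k, f k (x k) :=
      Finset.measurable_prod _ fun k _ => (hf k).comp (measurable_pi_apply k)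
    have hm' : Measurable fun x : Fin N → X => ∏ k : Fin N, f k.succ (x k) :=
      Finset.measurable_prod _ fun k _ => (hf k.succ).comp (measurable_pi_apply k)
    rw [← ((measurePreserving_piFinSuccAbove μ 0).symm).lintegral_comp hm]
    have e (p : X × (Fin N → X)) :
        ∏ k, f k ((MeasurableEquiv.piFinSuccAbove (fun _ => X) 0).symm p k) =
          f 0 p.1 * ∏ k : Fin N, f k.succ (p.2 k) := by
      rw [Fin.prod_univ_succ]
      simp [MeasurableEquiv.piFinSuccAbove_symm_apply, Fin.insertNthEquiv]
    simp_rw [e]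
    refine (lintegral_prod_mul (hf 0).aemeasurable hm'.aemeasurable).trans ?_
    rw [Fin.prod_univ_succ]
    exact congrArg _ (ih (fun k => μ k.succ) fun k => hf k.succ)

lemma pi_withDensity {N : ℕ} {X : Type*} [MeasurableSpace X] (μ : Fin N → Measure X)
    [∀ k, SigmaFinite (μ k)] {f : Fin N → X → ℝ≥0∞} (hf : ∀ k, Measurable (f k))
    [∀ k, SigmaFinite ((μ k).withDensity (f k))] :
    Measure.pi (fun k => (μ k).withDensity (f k)) =
      (Measure.pi μ).withDensity fun x => ∏ k, f k (x k) := by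
  refine Measure.pi_eq fun s hs => ?_
  rw [withDensity_apply _ (MeasurableSet.univ_pi hs), ← lintegral_indicator (.univ_pi hs)]
  have e : (Set.univ.pi s).indicator (fun x => ∏ k, f k (x k)) =
      fun x => ∏ k, (s k).indicator (f k) (x k) := by
    funext x
    by_cases hx : x ∈ Set.univ.pi s
    · rw [Set.indicator_of_mem hx]
      exact Finset.prod_congr rfl fun k _ => (Set.indicator_of_mem (hx k trivial) _).symm
    · rw [Set.indicator_of_notMem hx]
      simp only [Set.mem_pi, Set.mem_univ, true_imp_iff, not_forall] at hx
      obtain ⟨k, hk⟩ := hx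
      exact (Finset.prod_eq_zero (Finset.mem_univ k) (Set.indicator_of_notMem hk _)).symm
  rw [e, lintegral_pi_prod μ fun k => (hf k).indicator (hs k)]
  refine Finset.prod_congr rfl fun k _ => ?_
  rw [lintegral_indicator (hs k), withDensity_apply _ (hs k)]

/-- Regrouping the coordinates of a product measure in pairs. -/
lemma map_pi_prod {ι κ X : Type*} [Fintype ι] [Fintype κ] [MeasurableSpace X]
    (e : ι × Bool ≃ κ) (μ : κ → Measure X) [∀ j, SigmaFinite (μ j)] :
    (Measure.pi fun k => (μ (e (k, false))).prod (μ (e (k, true)))).map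
      (fun p j => if (e.symm j).2 then (p (e.symm j).1).2 else (p (e.symm j).1).1) =
      Measure.pi μ := by
  have hm : Measurable fun (p : ι → X × X) (j : κ) =>
      if (e.symm j).2 then (p (e.symm j).1).2 else (p (e.symm j).1).1 := by
    refine measurable_pi_lambda _ fun j => ?_
    split_ifs
    · exact measurable_snd.comp (measurable_pi_apply _)
    · exact measurable_fst.comp (measurable_pi_apply _)
  refine (Measure.pi_eq fun s hs => ?_).symm
  rw [Measure.map_apply hm (.univ_pi hs)]
  have hpre : (fun (p : ι → X × X) (j : κ) =>
      if (e.symm j).2 then (p (e.symm j).1).2 else (p (e.symm j).1).1) ⁻¹' Set.univ.pi s =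
      Set.univ.pi fun k => s (e (k, false)) ×ˢ s (e (k, true)) := by
    ext p
    simp only [Set.mem_preimage, Set.mem_pi, Set.mem_univ, true_imp_iff, Set.mem_prod]
    constructor
    · intro h k
      have h0 := h (e (k, false))
      have h1 := h (e (k, true))
      simp only [Equiv.symm_apply_apply] at h0 h1
      exact ⟨by simpa using h0, by simpa using h1⟩
    · intro h j
      obtain ⟨⟨k, b⟩, rfl⟩ := e.surjective j
      simp only [Equiv.symm_apply_apply]
      cases b
      · simpa using (h k).1
      · simpa using (h k).2
  rw [hpre, Measure.pi_pi, ← Equiv.prod_comp e, Fintype.prod_prod_type]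
  refine Finset.prod_congr rfl fun k _ => ?_
  rw [Measure.prod_prod, Fintype.prod_bool, mul_comm]

end PiMeasures

lemma lintegral_pi_checkLaw {N : ℕ} (s : Fin N → Bool) (μ ν : Fin N → SoftLaw)
    {G : (Fin N → SoftBit) → ℝ≥0∞} (hG : Measurable G) :
    ∫⁻ d, G d ∂(Measure.pi fun k => (checkLaw (s k) (μ k) (ν k) : Measure SoftBit)) =
      ∫⁻ p, G (fun k => checkBit (s k) (p k).1 (p k).2)
        ∂(Measure.pi fun k => (μ k : Measure SoftBit).prod (ν k : Measure SoftBit)) := by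
  have hprob (k : Fin N) : IsProbabilityMeasure (((μ k : Measure SoftBit).prod (ν k : Measure SoftBit)).map
      fun p => checkBit (s k) p.1 p.2) :=
    Measure.isProbabilityMeasure_map (measurable_checkBit _).aemeasurable
  simp_rw [coe_checkLaw]
  rw [← Measure.pi_map_pi fun k => (measurable_checkBit (s k)).aemeasurable, lintegral_map hG]
  exact measurable_pi_lambda _ fun k => (measurable_checkBit (s k)).comp (measurable_pi_apply k)

/-- Each factor is a sum of two measures indexed by the known bit; expanding their product gives a
sum over known words a. The identity of measures is checked on boxes. -/
lemma lintegral_pi_varLaw {N : ℕ} (s : Fin N → Bool) (μ ν : Fin N → SoftLaw)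
    {G : (Fin N → SoftBit) → ℝ≥0∞} (hG : Measurable G) :
    ∫⁻ d, G d ∂(Measure.pi fun k => (varLaw (s k) (μ k) (ν k) : Measure SoftBit)) =
      ∫⁻ p, ∑ a : Fin N → ZMod 2,
        (∏ k, (posterior (checkBit (s k) (p k).1 (p k).2) (a k) : ℝ≥0∞)) *
          G (fun k => varBit (s k) (a k) (p k).1 (p k).2)
        ∂(Measure.pi fun k => (μ k : Measure SoftBit).prod (ν k : Measure SoftBit)) := by
  set P := Measure.pi fun k => (μ k : Measure SoftBit).prod (ν k : Measure SoftBit)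
  have hw (a : Fin N → ZMod 2) : Measurable fun p : Fin N → SoftBit × SoftBit =>
      ∏ k, (posterior (checkBit (s k) (p k).1 (p k).2) (a k) : ℝ≥0∞) :=
    Finset.measurable_prod _ fun k _ =>
      (measurable_posterior_checkBit (s k) (a k)).coe_nnreal_ennreal.comp (measurable_pi_apply k)
  have hD (a : Fin N → ZMod 2) : Measurable fun (p : Fin N → SoftBit × SoftBit) k =>
      varBit (s k) (a k) (p k).1 (p k).2 :=
    measurable_pi_lambda _ fun k => (measurable_varBit (s k) (a k)).comp (measurable_pi_apply k)
  set M := ∑ a : Fin N → ZMod 2, (P.withDensity fun p =>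
      ∏ k, (posterior (checkBit (s k) (p k).1 (p k).2) (a k) : ℝ≥0∞)).map
        fun p k => varBit (s k) (a k) (p k).1 (p k).2 with hM
  have hint {H : (Fin N → SoftBit) → ℝ≥0∞} (hH : Measurable H) :
      ∫⁻ d, H d ∂M = ∑ a : Fin N → ZMod 2,
        ∫⁻ p, (∏ k, (posterior (checkBit (s k) (p k).1 (p k).2) (a k) : ℝ≥0∞)) *
          H (fun k => varBit (s k) (a k) (p k).1 (p k).2) ∂P := by
    rw [hM, lintegral_finsetSum_measure]
    refine Finset.sum_congr rfl fun a _ => ?_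
    rw [lintegral_map hH (hD a)]
    exact lintegral_withDensity_eq_lintegral_mul _ (hw a) (hH.comp (hD a))
  have hpi : Measure.pi (fun k => (varLaw (s k) (μ k) (ν k) : Measure SoftBit)) = M := by
    refine Measure.pi_eq fun t ht => ?_
    have hvar (k : Fin N) : (varLaw (s k) (μ k) (ν k) : Measure SoftBit) (t k) =
        ∑ a, ∫⁻ p, (posterior (checkBit (s k) p.1 p.2) a : ℝ≥0∞) *
          (t k).indicator 1 (varBit (s k) a p.1 p.2) ∂((μ k : Measure SoftBit).prod (ν k : Measure SoftBit)) := by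
      rw [← lintegral_indicator_one (ht k), coe_varLaw, lintegral_finsetSum_measure]
      exact Finset.sum_congr rfl fun a _ =>
        lintegral_varPart _ _ _ a (measurable_one.indicator (ht k))
    rw [← lintegral_indicator_one (.univ_pi ht), hint (measurable_one.indicator (.univ_pi ht))]
    simp_rw [hvar]
    rw [Finset.prod_univ_sum, Fintype.piFinset_univ]
    refine Finset.sum_congr rfl fun a _ => ?_
    rw [← lintegral_pi_prod (fun k => (μ k : Measure SoftBit).prod (ν k : Measure SoftBit))
      (f := fun k p => (posterior (checkBit (s k) p.1 p.2) (a k) : ℝ≥0∞) *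
          (t k).indicator 1 (varBit (s k) (a k) p.1 p.2)) fun k =>
        (measurable_posterior_checkBit (s k) (a k)).coe_nnreal_ennreal.mul
          ((measurable_one.indicator (ht k)).comp (measurable_varBit (s k) (a k)))]
    refine lintegral_congr fun p => ?_
    rw [Finset.prod_mul_distrib]
    congr 1
    classical
    simp only [Set.indicator_apply, Set.mem_pi, Set.mem_univ, true_imp_iff, Pi.one_apply]
    rw [Finset.prod_ite_zero]
    simp
  rw [hpi, hint hG, lintegral_finsetSum]
  exact fun a _ => (hw a).mul (hG.comp (hD a))

/-! ### Marginals, root sums and the two halves of a word. -/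

/-- The weight of the words that continue `past` before position `i` with the bit `b`, when the
symbol `x` at position `k` of the codeword has weight `ℓ k x`. -/
noncomputable def marginal {N : ℕ} (enc : (Fin N → ZMod 2) → (Fin N → ZMod 2))
    (ℓ : Fin N → ZMod 2 → ℝ≥0) (i : Fin N) (past : Fin N → ZMod 2) (b : ZMod 2) : ℝ≥0 :=
  ∑ u : Fin N → ZMod 2 with (∀ j, j < i → u j = past j) ∧ u i = b, ∏ k, ℓ k (enc u k)

/-- The sum over the possible pasts (padded with zeros) of the geometric mean of the two
marginals. -/
noncomputable def rootSum {N : ℕ} (enc : (Fin N → ZMod 2) → (Fin N → ZMod 2))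
    (ℓ : Fin N → ZMod 2 → ℝ≥0) (i : Fin N) : ℝ≥0 :=
  ∑ v : Fin N → ZMod 2 with ∀ j, i ≤ j → v j = 0,
    NNReal.sqrt (marginal enc ℓ i v 0 * marginal enc ℓ i v 1)

lemma marginal_mul {N : ℕ} (enc : (Fin N → ZMod 2) → (Fin N → ZMod 2)) (w : Fin N → ℝ≥0)
    (ℓ : Fin N → ZMod 2 → ℝ≥0) (i : Fin N) (past : Fin N → ZMod 2) (b : ZMod 2) :
    marginal enc (fun k x => w k * ℓ k x) i past b = (∏ k, w k) * marginal enc ℓ i past b := by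
  simp_rw [marginal, Finset.prod_mul_distrib, ← Finset.mul_sum]

/-- Weights independent of the symbol scale both marginals equally and leave the geometric mean as
one factor. This later extracts the posterior of the known word and the mean output density. -/
lemma rootSum_mul {N : ℕ} (enc : (Fin N → ZMod 2) → (Fin N → ZMod 2)) (w : Fin N → ℝ≥0)
    (ℓ : Fin N → ZMod 2 → ℝ≥0) (i : Fin N) :
    rootSum enc (fun k x => w k * ℓ k x) i = (∏ k, w k) * rootSum enc ℓ i := by
  have key (P x y : ℝ≥0) : NNReal.sqrt (P * x * (P * y)) = P * NNReal.sqrt (x * y) := by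
    rw [mul_mul_mul_comm, NNReal.sqrt_mul, NNReal.sqrt_mul_self]
  simp_rw [rootSum, marginal_mul, key, ← Finset.mul_sum]

/-- The position `i` of the first half. -/
def lowerIndex {n : ℕ} (i : Fin (2 ^ n)) : Fin (2 ^ (n + 1)) :=
  ⟨i.1, by have := i.2; have := pow_succ 2 n; omega⟩

/-- The position `i` of the second half. -/
def upperIndex {n : ℕ} (i : Fin (2 ^ n)) : Fin (2 ^ (n + 1)) :=
  ⟨2 ^ n + i.1, by have := i.2; have := pow_succ 2 n; omega⟩

lemma forall_index_iff {n : ℕ} {p : Fin (2 ^ (n + 1)) → Prop} :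
    (∀ j, p j) ↔ (∀ k, p (lowerIndex k)) ∧ ∀ k, p (upperIndex k) := by
  refine ⟨fun h => ⟨fun k => h _, fun k => h _⟩, fun ⟨h1, h2⟩ j => ?_⟩
  by_cases hj : j.1 < 2 ^ n
  · exact h1 ⟨j.1, hj⟩
  · have hj2 : j.1 - 2 ^ n < 2 ^ n := by
      have := j.2; have := pow_succ 2 n; omega
    have e : upperIndex ⟨j.1 - 2 ^ n, hj2⟩ = j := Fin.ext (by simp [upperIndex]; omega)
    exact e ▸ h2 ⟨j.1 - 2 ^ n, hj2⟩

lemma lowerIndex_lt_lowerIndex {n : ℕ} {i j : Fin (2 ^ n)} : lowerIndex i < lowerIndex j ↔ i < j :=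
  Iff.rfl

lemma lowerIndex_le_lowerIndex {n : ℕ} {i j : Fin (2 ^ n)} : lowerIndex i ≤ lowerIndex j ↔ i ≤ j :=
  Iff.rfl

lemma upperIndex_lt_upperIndex {n : ℕ} {i j : Fin (2 ^ n)} :
    upperIndex i < upperIndex j ↔ i < j := by
  rw [Fin.lt_def, Fin.lt_def]
  exact Nat.add_lt_add_iff_left

lemma upperIndex_le_upperIndex {n : ℕ} {i j : Fin (2 ^ n)} :
    upperIndex i ≤ upperIndex j ↔ i ≤ j := by
  rw [Fin.le_def, Fin.le_def]
  exact Nat.add_le_add_iff_left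

lemma lowerIndex_lt_upperIndex {n : ℕ} (i j : Fin (2 ^ n)) : lowerIndex i < upperIndex j := by
  have := i.2
  simp only [lowerIndex, upperIndex, Fin.lt_def]
  omega

/-- Splitting a word into its two halves. -/
def halvesEquiv (n : ℕ) :
    (Fin (2 ^ (n + 1)) → ZMod 2) ≃ (Fin (2 ^ n) → ZMod 2) × (Fin (2 ^ n) → ZMod 2) where
  toFun u := (firstHalf u, secondHalf u)
  invFun p j := if h : j.1 < 2 ^ n then p.1 ⟨j.1, h⟩
    else p.2 ⟨j.1 - 2 ^ n, by have := j.2; have := pow_succ 2 n; omega⟩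
  left_inv u := by
    funext j
    revert j
    rw [forall_index_iff]
    constructor
    · intro k
      simp [lowerIndex, firstHalf]
    · intro k
      simp [upperIndex, secondHalf]
  right_inv p := by
    ext k
    · simp [firstHalf]
    · simp [secondHalf]

lemma sum_eq_sum_halves {M : Type*} [AddCommMonoid M] {n : ℕ}
    (f : (Fin (2 ^ n) → ZMod 2) → (Fin (2 ^ n) → ZMod 2) → M) :
    ∑ u : Fin (2 ^ (n + 1)) → ZMod 2, f (firstHalf u) (secondHalf u) = ∑ a, ∑ b, f a b := by
  rw [← Fintype.sum_prod_type']
  exact (halvesEquiv n).sum_comp fun p => f p.1 p.2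

lemma continues_lowerIndex_iff {n : ℕ} {i : Fin (2 ^ n)} {b : ZMod 2}
    {u v : Fin (2 ^ (n + 1)) → ZMod 2} :
    ((∀ j, j < lowerIndex i → u j = v j) ∧ u (lowerIndex i) = b) ↔
      (∀ j, j < i → firstHalf u j = firstHalf v j) ∧ firstHalf u i = b := by
  rw [forall_index_iff]
  simp only [lowerIndex_lt_lowerIndex, (lowerIndex_lt_upperIndex _ _).not_gt, false_imp_iff,
    implies_true, and_true]
  rfl

lemma continues_upperIndex_iff {n : ℕ} {i : Fin (2 ^ n)} {b : ZMod 2}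
    {u v : Fin (2 ^ (n + 1)) → ZMod 2} :
    ((∀ j, j < upperIndex i → u j = v j) ∧ u (upperIndex i) = b) ↔
      firstHalf u = firstHalf v ∧
        ((∀ j, j < i → secondHalf u j = secondHalf v j) ∧ secondHalf u i = b) := by
  rw [forall_index_iff]
  simp only [upperIndex_lt_upperIndex, lowerIndex_lt_upperIndex, true_imp_iff, and_assoc,
    funext_iff]
  rfl

lemma vanishes_lowerIndex_iff {n : ℕ} {i : Fin (2 ^ n)} {v : Fin (2 ^ (n + 1)) → ZMod 2} :
    (∀ j, lowerIndex i ≤ j → v j = 0) ↔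
      secondHalf v = 0 ∧ ∀ j, i ≤ j → firstHalf v j = 0 := by
  rw [forall_index_iff]
  simp only [lowerIndex_le_lowerIndex, (lowerIndex_lt_upperIndex _ _).le, true_imp_iff,
    funext_iff]
  rw [and_comm]
  rfl

lemma vanishes_upperIndex_iff {n : ℕ} {i : Fin (2 ^ n)} {v : Fin (2 ^ (n + 1)) → ZMod 2} :
    (∀ j, upperIndex i ≤ j → v j = 0) ↔ ∀ j, i ≤ j → secondHalf v j = 0 := by
  rw [forall_index_iff]
  simp only [upperIndex_le_upperIndex, (lowerIndex_lt_upperIndex _ _).not_ge, false_imp_iff,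
    implies_true, true_and]
  rfl

/-! ### Bit-channels of an encoder with one more layer. -/

/-- The encoder `enc` encodes the two halves of a word with `T` and combines the pairs of results
by one layer of XOR operations, of which those marked by `s` are retained; the result of the
operation on the `k`-th pair is sent at the positions `e (k, false)` and `e (k, true)`. -/
structure IsPartialLayer {n : ℕ} (T : (Fin (2 ^ n) → ZMod 2) → (Fin (2 ^ n) → ZMod 2))
    (s : Fin (2 ^ n) → Bool) (e : Fin (2 ^ n) × Bool ≃ Fin (2 ^ (n + 1)))
    (enc : (Fin (2 ^ (n + 1)) → ZMod 2) → (Fin (2 ^ (n + 1)) → ZMod 2)) : Prop where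
  bijective : Function.Bijective T
  apply_false : ∀ u k, enc u (e (k, false)) =
    if s k then T (firstHalf u) k + T (secondHalf u) k else T (firstHalf u) k
  apply_true : ∀ u k, enc u (e (k, true)) = T (secondHalf u) k

namespace IsPartialLayer

variable {n : ℕ} {T : (Fin (2 ^ n) → ZMod 2) → (Fin (2 ^ n) → ZMod 2)}
  {s : Fin (2 ^ n) → Bool} {e : Fin (2 ^ n) × Bool ≃ Fin (2 ^ (n + 1))}
  {enc : (Fin (2 ^ (n + 1)) → ZMod 2) → (Fin (2 ^ (n + 1)) → ZMod 2)}

lemma prod_eq (h : IsPartialLayer T s e enc) (ℓ : Fin (2 ^ (n + 1)) → ZMod 2 → ℝ≥0)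
    (u : Fin (2 ^ (n + 1)) → ZMod 2) :
    ∏ j, ℓ j (enc u j) = ∏ k,
      (ℓ (e (k, false)) (if s k then T (firstHalf u) k + T (secondHalf u) k
        else T (firstHalf u) k) * ℓ (e (k, true)) (T (secondHalf u) k)) := by
  rw [← Equiv.prod_comp e, Fintype.prod_prod_type]
  refine Finset.prod_congr rfl fun k _ => ?_
  rw [Fintype.prod_bool, h.apply_false, h.apply_true, mul_comm]

/-- The second half is unconstrained, and T is bijective, so its transform runs over all words; the
sum of products then becomes a product of sums over single symbols. -/
lemma marginal_lowerIndex (h : IsPartialLayer T s e enc) (ℓ : Fin (2 ^ (n + 1)) → ZMod 2 → ℝ≥0)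
    (i : Fin (2 ^ n)) (past : Fin (2 ^ (n + 1)) → ZMod 2) (b : ZMod 2) :
    marginal enc ℓ (lowerIndex i) past b =
      marginal T (fun k a => ∑ b', ℓ (e (k, false)) (if s k then a + b' else a) *
        ℓ (e (k, true)) b') i (firstHalf past) b := by
  rw [marginal, marginal, Finset.sum_filter, Finset.sum_filter]
  simp_rw [continues_lowerIndex_iff, h.prod_eq]
  rw [sum_eq_sum_halves fun u₁ u₂ => if (∀ j, j < i → u₁ j = firstHalf past j) ∧ u₁ i = b then
    ∏ k, (ℓ (e (k, false)) (if s k then T u₁ k + T u₂ k else T u₁ k) *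
      ℓ (e (k, true)) (T u₂ k)) else 0]
  refine Finset.sum_congr rfl fun u₁ _ => ?_
  split_ifs
  · rw [h.bijective.sum_comp fun v => ∏ k, (ℓ (e (k, false))
      (if s k then T u₁ k + v k else T u₁ k) * ℓ (e (k, true)) (v k)),
      Finset.prod_univ_sum, Fintype.piFinset_univ]
  · exact Finset.sum_const_zero

/-- The past contains the whole first half, so only one first half contributes and its transform
acts as a known word. -/
lemma marginal_upperIndex (h : IsPartialLayer T s e enc) (ℓ : Fin (2 ^ (n + 1)) → ZMod 2 → ℝ≥0)
    (i : Fin (2 ^ n)) (past : Fin (2 ^ (n + 1)) → ZMod 2) (b : ZMod 2) :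
    marginal enc ℓ (upperIndex i) past b =
      marginal T (fun k b' => ℓ (e (k, false)) (if s k then T (firstHalf past) k + b'
        else T (firstHalf past) k) * ℓ (e (k, true)) b') i (secondHalf past) b := by
  rw [marginal, marginal, Finset.sum_filter, Finset.sum_filter]
  simp_rw [continues_upperIndex_iff, h.prod_eq]
  rw [sum_eq_sum_halves fun u₁ u₂ => if u₁ = firstHalf past ∧
    ((∀ j, j < i → u₂ j = secondHalf past j) ∧ u₂ i = b) then
    ∏ k, (ℓ (e (k, false)) (if s k then T u₁ k + T u₂ k else T u₁ k) *
      ℓ (e (k, true)) (T u₂ k)) else 0]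
  rw [Finset.sum_eq_single (firstHalf past)]
  · simp
  · intro u₁ _ hne
    simp [hne]
  · simp

lemma rootSum_lowerIndex (h : IsPartialLayer T s e enc) (ℓ : Fin (2 ^ (n + 1)) → ZMod 2 → ℝ≥0)
    (i : Fin (2 ^ n)) :
    rootSum enc ℓ (lowerIndex i) =
      rootSum T (fun k a => ∑ b, ℓ (e (k, false)) (if s k then a + b else a) *
        ℓ (e (k, true)) b) i := by
  rw [rootSum, rootSum, Finset.sum_filter, Finset.sum_filter]
  simp_rw [h.marginal_lowerIndex, vanishes_lowerIndex_iff]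
  set ℓ' : Fin (2 ^ n) → ZMod 2 → ℝ≥0 := fun k a => ∑ b, ℓ (e (k, false))
    (if s k then a + b else a) * ℓ (e (k, true)) b
  rw [sum_eq_sum_halves fun v₁ v₂ => if v₂ = 0 ∧ (∀ j, i ≤ j → v₁ j = 0) then
    NNReal.sqrt (marginal T ℓ' i v₁ 0 * marginal T ℓ' i v₁ 1) else 0]
  refine Finset.sum_congr rfl fun v₁ _ => ?_
  rw [Finset.sum_eq_single 0]
  · simp
  · intro v₂ _ hne
    simp [hne]
  · simp

/-- The pasts run over all first halves; bijectivity of T replaces these by their transforms a. -/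
lemma rootSum_upperIndex (h : IsPartialLayer T s e enc) (ℓ : Fin (2 ^ (n + 1)) → ZMod 2 → ℝ≥0)
    (i : Fin (2 ^ n)) :
    rootSum enc ℓ (upperIndex i) = ∑ a : Fin (2 ^ n) → ZMod 2,
      rootSum T (fun k b => ℓ (e (k, false)) (if s k then a k + b else a k) *
        ℓ (e (k, true)) b) i := by
  rw [← h.bijective.sum_comp]
  simp_rw [rootSum, Finset.sum_filter, h.marginal_upperIndex, vanishes_upperIndex_iff]
  exact sum_eq_sum_halves fun v₁ v₂ => if (∀ j, i ≤ j → v₂ j = 0) then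
    NNReal.sqrt (marginal T (fun k b => ℓ (e (k, false)) (if s k then T v₁ k + b else T v₁ k) *
        ℓ (e (k, true)) b) i v₂ 0 * marginal T (fun k b => ℓ (e (k, false))
        (if s k then T v₁ k + b else T v₁ k) * ℓ (e (k, true)) b) i v₂ 1) else 0

end IsPartialLayer

/-- Half the Bhattacharyya parameter of the `i`-th bit-channel of the encoder `enc` on independent
channels with soft bit laws `c k`. -/
noncomputable def bitBhatt {N : ℕ} (enc : (Fin N → ZMod 2) → (Fin N → ZMod 2))
    (c : Fin N → SoftLaw) (i : Fin N) : ℝ≥0∞ :=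
  ∫⁻ d, rootSum enc (fun k => posterior (d k)) i ∂(Measure.pi fun k => (c k : Measure SoftBit))

lemma measurable_marginal {N : ℕ} {Ω : Type*} [MeasurableSpace Ω]
    (enc : (Fin N → ZMod 2) → (Fin N → ZMod 2)) {ℓ : Ω → Fin N → ZMod 2 → ℝ≥0}
    (hℓ : ∀ k x, Measurable fun ω => ℓ ω k x) (i : Fin N) (past : Fin N → ZMod 2) (b : ZMod 2) :
    Measurable fun ω => marginal enc (ℓ ω) i past b :=
  Finset.measurable_sum _ fun u _ => Finset.measurable_prod _ fun k _ => hℓ k (enc u k)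

lemma measurable_rootSum {N : ℕ} {Ω : Type*} [MeasurableSpace Ω]
    (enc : (Fin N → ZMod 2) → (Fin N → ZMod 2)) {ℓ : Ω → Fin N → ZMod 2 → ℝ≥0}
    (hℓ : ∀ k x, Measurable fun ω => ℓ ω k x) (i : Fin N) :
    Measurable fun ω => rootSum enc (ℓ ω) i :=
  Finset.measurable_sum _ fun v _ => NNReal.continuous_sqrt.measurable.comp
    ((measurable_marginal enc hℓ i v 0).mul (measurable_marginal enc hℓ i v 1))

lemma measurable_rootSum_posterior {N : ℕ} (enc : (Fin N → ZMod 2) → (Fin N → ZMod 2))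
    (i : Fin N) : Measurable fun d : Fin N → SoftBit =>
      (rootSum enc (fun k => posterior (d k)) i : ℝ≥0∞) :=
  (measurable_rootSum enc (fun k x => (measurable_posterior x).comp (measurable_pi_apply k))
    i).coe_nnreal_ennreal

namespace IsPartialLayer

variable {n : ℕ} {T : (Fin (2 ^ n) → ZMod 2) → (Fin (2 ^ n) → ZMod 2)}
  {s : Fin (2 ^ n) → Bool} {e : Fin (2 ^ n) × Bool ≃ Fin (2 ^ (n + 1))}
  {enc : (Fin (2 ^ (n + 1)) → ZMod 2) → (Fin (2 ^ (n + 1)) → ZMod 2)}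

lemma bitBhatt_eq_lintegral_prod (e : Fin (2 ^ n) × Bool ≃ Fin (2 ^ (n + 1)))
    (enc : (Fin (2 ^ (n + 1)) → ZMod 2) → (Fin (2 ^ (n + 1)) → ZMod 2))
    (c : Fin (2 ^ (n + 1)) → SoftLaw) (i : Fin (2 ^ (n + 1))) :
    bitBhatt enc c i = ∫⁻ p, rootSum enc (fun j => posterior
      (if (e.symm j).2 then (p (e.symm j).1).2 else (p (e.symm j).1).1)) i
      ∂(Measure.pi fun k => (c (e (k, false)) : Measure SoftBit).prod
        (c (e (k, true)) : Measure SoftBit)) := by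
  rw [bitBhatt, ← map_pi_prod e fun j => (c j : Measure SoftBit),
    lintegral_map (measurable_rootSum_posterior enc i)]
  refine measurable_pi_lambda _ fun j => ?_
  split_ifs
  · exact measurable_snd.comp (measurable_pi_apply _)
  · exact measurable_fst.comp (measurable_pi_apply _)

lemma bitBhatt_lowerIndex (h : IsPartialLayer T s e enc) (c : Fin (2 ^ (n + 1)) → SoftLaw)
    (i : Fin (2 ^ n)) : bitBhatt enc c (lowerIndex i) =
      bitBhatt T (fun k => checkLaw (s k) (c (e (k, false))) (c (e (k, true)))) i := by
  rw [bitBhatt_eq_lintegral_prod e, bitBhatt,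
    lintegral_pi_checkLaw s _ _ (measurable_rootSum_posterior T i)]
  simp_rw [h.rootSum_lowerIndex, Equiv.symm_apply_apply, if_true, Bool.false_eq_true, if_false,
    sum_posterior_mul_posterior]

/-- For each known word a the posteriors factor by `posterior_mul_posterior`; homogeneity of
`rootSum` pulls out precisely the weights that appear in `lintegral_pi_varLaw`. -/
lemma bitBhatt_upperIndex (h : IsPartialLayer T s e enc) (c : Fin (2 ^ (n + 1)) → SoftLaw)
    (i : Fin (2 ^ n)) : bitBhatt enc c (upperIndex i) =
      bitBhatt T (fun k => varLaw (s k) (c (e (k, false))) (c (e (k, true)))) i := by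
  rw [bitBhatt_eq_lintegral_prod e, bitBhatt,
    lintegral_pi_varLaw s _ _ (measurable_rootSum_posterior T i)]
  simp_rw [h.rootSum_upperIndex, Equiv.symm_apply_apply, if_true, Bool.false_eq_true, if_false,
    posterior_mul_posterior, rootSum_mul, ENNReal.ofNNReal_finsetSum, ENNReal.coe_mul,
    ENNReal.ofNNReal_finsetProd]

end IsPartialLayer

namespace IsPartialLayer

variable {n : ℕ} {T : (Fin (2 ^ n) → ZMod 2) → (Fin (2 ^ n) → ZMod 2)}
  {s : Fin (2 ^ n) → Bool} {e : Fin (2 ^ n) × Bool ≃ Fin (2 ^ (n + 1))}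
  {enc : (Fin (2 ^ (n + 1)) → ZMod 2) → (Fin (2 ^ (n + 1)) → ZMod 2)}

lemma bijective_enc (h : IsPartialLayer T s e enc) : Function.Bijective enc := by
  rw [← Finite.injective_iff_bijective]
  intro u v huv
  have h2 : secondHalf u = secondHalf v := h.bijective.1 <| funext fun k => by
    rw [← h.apply_true, ← h.apply_true, huv]
  have h1 : firstHalf u = firstHalf v := h.bijective.1 <| funext fun k => by
    have := congrFun huv (e (k, false))
    rw [h.apply_false, h.apply_false, h2] at this
    split_ifs at this
    · exact add_right_cancel this
    · exact this
  exact (halvesEquiv n).injective (Prod.ext h1 h2)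

end IsPartialLayer

/-! ### The polar and PPP transforms as layered encoders. -/

/-- Interleaving: the pair `k` occupies the positions `2 k` and `2 k + 1`. -/
def interleave (n : ℕ) : Fin (2 ^ n) × Bool ≃ Fin (2 ^ (n + 1)) where
  toFun p := ⟨2 * p.1.1 + p.2.toNat, by
    have := p.1.2; have := pow_succ 2 n; have := p.2.toNat_le; omega⟩
  invFun j := (⟨j.1 / 2, by have := j.2; have := pow_succ 2 n; omega⟩, decide (j.1 % 2 = 1))
  left_inv := by
    rintro ⟨k, b⟩
    cases b
    · simp
    · ext
      · simp; omega
      · simp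
  right_inv j := by
    rcases Nat.mod_two_eq_zero_or_one j.1 with h | h <;> ext <;> simp [h] <;> omega

/-- Concatenation: the pair `k` occupies the positions `k` of both halves. -/
def concatenate (n : ℕ) : Fin (2 ^ n) × Bool ≃ Fin (2 ^ (n + 1)) where
  toFun p := if p.2 then upperIndex p.1 else lowerIndex p.1
  invFun j := if h : j.1 < 2 ^ n then (⟨j.1, h⟩, false)
    else (⟨j.1 - 2 ^ n, by have := j.2; have := pow_succ 2 n; omega⟩, true)
  left_inv := by
    rintro ⟨k, b⟩
    cases b
    · simp [lowerIndex]
    · simp [upperIndex]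
  right_inv j := by
    by_cases h : j.1 < 2 ^ n
    · simp [h, lowerIndex]
    · ext
      simp only [h, dite_false, if_true, upperIndex]
      omega

lemma isPartialLayer_polarTransform_succ {n : ℕ} (h : Function.Bijective (polarTransform n)) :
    IsPartialLayer (polarTransform n) (fun _ => true) (interleave n) (polarTransform (n + 1)) where
  bijective := h
  apply_false u k := by
    simp [polarTransform, interleave]
  apply_true u k := by
    have h1 : (2 * k.1 + 1) % 2 = 1 := by omega
    have h2 : (2 * k.1 + 1) / 2 = k.1 := by omega
    simp [polarTransform, interleave, h1, h2]

lemma polarTransform_bijective (n : ℕ) : Function.Bijective (polarTransform n) := by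
  induction n with
  | zero => exact Function.bijective_id
  | succ n ih => exact (isPartialLayer_polarTransform_succ ih).bijective_enc

lemma isPartialLayer_polarTransform (n : ℕ) :
    IsPartialLayer (polarTransform n) (fun _ => true) (interleave n) (polarTransform (n + 1)) :=
  isPartialLayer_polarTransform_succ (polarTransform_bijective n)

lemma isPartialLayer_pppTransform (m lam n : ℕ) :
    IsPartialLayer (polarTransform n) (fun k => decide (k.1 % 2 ^ m < lam)) (concatenate n)
      (pppTransform m lam n) where
  bijective := polarTransform_bijective n
  apply_false u k := by
    simp [pppTransform, concatenate, lowerIndex]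
  apply_true u k := by
    simp [pppTransform, concatenate, upperIndex]

lemma marginal_id_one (ℓ : Fin 1 → ZMod 2 → ℝ≥0) (i : Fin 1) (past : Fin 1 → ZMod 2)
    (b : ZMod 2) : marginal (fun u => u) ℓ i past b = ℓ i b := by
  rw [marginal, Finset.sum_eq_single fun _ => b]
  · rw [Fin.prod_univ_one, Subsingleton.elim i 0]
  · intro u hu hne
    refine absurd (funext fun j => ?_) hne
    rw [Subsingleton.elim j i]
    exact (Finset.mem_filter.1 hu).2.2
  · intro h
    refine absurd (Finset.mem_filter.2 ⟨Finset.mem_univ _, fun j hj => ?_, rfl⟩) h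
    exact absurd (Subsingleton.elim j i) hj.ne

lemma rootSum_id_one (d : SoftBit) (i : Fin 1) :
    rootSum (fun u => u) (fun _ => posterior d) i = bhattBit d := by
  simp_rw [rootSum, marginal_id_one]
  rw [Finset.sum_eq_single 0]
  · rfl
  · intro v hv hne
    refine absurd (funext fun j => ?_) hne
    exact (Finset.mem_filter.1 hv).2 j (Subsingleton.elim i j).le
  · intro h
    exact absurd (Finset.mem_filter.2 ⟨Finset.mem_univ _, fun _ _ => rfl⟩) h

lemma lintegral_bhattBit (μ : SoftLaw) :
    ∫⁻ d, (bhattBit d : ℝ≥0∞) ∂(μ : Measure SoftBit) = ENNReal.ofReal (bhatt μ / 2) := by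
  have h : bhatt μ / 2 = ∫ d, (bhattBit d : ℝ) ∂(μ : Measure SoftBit) := by
    rw [bhatt, integral_const_mul, mul_div_cancel_left₀ _ two_ne_zero]
  rw [h, ofReal_integral_eq_lintegral_ofReal]
  · simp
  · exact integrable_of_bound (C := 1) measurable_bhattBit.coe_nnreal_real fun d => by
      rw [NNReal.abs_eq]
      linarith [two_mul_bhattBit_le_one d, (bhattBit d).2]
  · exact Eventually.of_forall fun d => (bhattBit d).2

/-- This identifies the bit-channels of the encoder with the recursion `polarLaw`. The family c
varies in the induction, because a layer changes the channels seen by each half. -/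
lemma bitBhatt_polarTransform (n : ℕ) (c : ℕ → SoftLaw) (i : Fin (2 ^ n)) :
    bitBhatt (polarTransform n) (fun k => c k) i =
      ENNReal.ofReal (bhatt (polarLaw n c i) / 2) := by
  induction n generalizing c with
  | zero =>
    change bitBhatt (N := 1) (fun u => u) (fun k => c k) i = ENNReal.ofReal (bhatt (c 0) / 2)
    rw [← lintegral_bhattBit, bitBhatt]
    have h := measurePreserving_eval (fun k : Fin 1 => (c k : Measure SoftBit)) 0
    have h' := h.lintegral_comp measurable_bhattBit.coe_nnreal_ennreal
    refine Eq.trans ?_ h'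
    refine lintegral_congr fun d => ?_
    rw [← rootSum_id_one (Function.eval 0 d) i]
    congr 2
    funext k
    rw [Subsingleton.elim k 0]
  | succ n ih =>
    revert i
    rw [forall_index_iff]
    constructor
    · intro k
      rw [(isPartialLayer_polarTransform n).bitBhatt_lowerIndex]
      have hk : (lowerIndex k).1 < 2 ^ n := k.2
      rw [polarLaw, if_pos hk]
      exact ih (checkFamily c) k
    · intro k
      rw [(isPartialLayer_polarTransform n).bitBhatt_upperIndex]
      have hk : ¬ (upperIndex k).1 < 2 ^ n := by simp [upperIndex]
      have hk' : (upperIndex k).1 - 2 ^ n = k := by simp [upperIndex]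
      rw [polarLaw, if_neg hk, hk']
      exact ih (varFamily c) k

/-! ### Reliable positions of the PPP transform and their number. -/

/-- The channels seen by the first segment of a PPP transform, after its inter-segment layer. -/
noncomputable def pppCheckFamily (m lam : ℕ) (μ : SoftLaw) (k : ℕ) : SoftLaw :=
  checkLaw (decide (k % 2 ^ m < lam)) μ μ

/-- The channels seen by the second segment of a PPP transform, after its inter-segment layer. -/
noncomputable def pppVarFamily (m lam : ℕ) (μ : SoftLaw) (k : ℕ) : SoftLaw :=
  varLaw (decide (k % 2 ^ m < lam)) μ μ

lemma bitBhatt_pppTransform_lowerIndex (m lam n : ℕ) (μ : SoftLaw) (i : Fin (2 ^ n)) :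
    bitBhatt (pppTransform m lam n) (fun _ => μ) (lowerIndex i) =
      ENNReal.ofReal (bhatt (polarLaw n (pppCheckFamily m lam μ) i) / 2) := by
  rw [(isPartialLayer_pppTransform m lam n).bitBhatt_lowerIndex]
  exact bitBhatt_polarTransform n (pppCheckFamily m lam μ) i

lemma bitBhatt_pppTransform_upperIndex (m lam n : ℕ) (μ : SoftLaw) (i : Fin (2 ^ n)) :
    bitBhatt (pppTransform m lam n) (fun _ => μ) (upperIndex i) =
      ENNReal.ofReal (bhatt (polarLaw n (pppVarFamily m lam μ) i) / 2) := by
  rw [(isPartialLayer_pppTransform m lam n).bitBhatt_upperIndex]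
  exact bitBhatt_polarTransform n (pppVarFamily m lam μ) i

lemma sum_index {M : Type*} [AddCommMonoid M] {n : ℕ} (f : Fin (2 ^ (n + 1)) → M) :
    ∑ j, f j = ∑ k, f (lowerIndex k) + ∑ k, f (upperIndex k) := by
  rw [← (concatenate n).sum_comp, Fintype.sum_prod_type, ← Finset.sum_add_distrib]
  refine Finset.sum_congr rfl fun k _ => ?_
  rw [Fintype.sum_bool, add_comm]
  rfl

/-- The positions whose bit-channel is reliable in the PPP transform. -/
noncomputable def reliablePositions (m lam n : ℕ) (μ : SoftLaw) : Finset (Fin (2 ^ (n + 1))) :=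
  open Classical in
  {j | bitBhatt (pppTransform m lam n) (fun _ => μ) j ≤ ENNReal.ofReal (1 / 4 ^ n)}

lemma mem_reliablePositions {m lam n : ℕ} {μ : SoftLaw} {j : Fin (2 ^ (n + 1))} :
    j ∈ reliablePositions m lam n μ ↔
      bitBhatt (pppTransform m lam n) (fun _ => μ) j ≤ ENNReal.ofReal (1 / 4 ^ n) := by
  simp [reliablePositions]

lemma card_compl_reliablePositions_le (m lam n : ℕ) (μ : SoftLaw) :
    (((reliablePositions m lam n μ)ᶜ.card : ℕ) : ℝ) ≤
      polarSum (unreliable (1 / 4 ^ n)) n (pppCheckFamily m lam μ) +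
        polarSum (unreliable (1 / 4 ^ n)) n (pppVarFamily m lam μ) := by
  classical
  have key {ν : SoftLaw} {j : Fin (2 ^ (n + 1))}
      (h : bitBhatt (pppTransform m lam n) (fun _ => μ) j = ENNReal.ofReal (bhatt ν / 2)) :
      (if j ∈ (reliablePositions m lam n μ)ᶜ then (1 : ℝ) else 0) ≤ unreliable (1 / 4 ^ n) ν := by
    split_ifs with hj
    · rw [Finset.mem_compl, mem_reliablePositions, h] at hj
      have : 1 / 4 ^ n < bhatt ν := by
        by_contra! hle
        -- `bitBhatt` is half of `bhatt`, so a factor 2 is to spare.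
        exact hj (ENNReal.ofReal_le_ofReal (by linarith [(bhatt_mem ν).1]))
      rw [unreliable, if_pos this]
    · exact unreliable_nonneg _ _
  have hcard : (((reliablePositions m lam n μ)ᶜ.card : ℕ) : ℝ) =
      ∑ j, if j ∈ (reliablePositions m lam n μ)ᶜ then (1 : ℝ) else 0 := by
    rw [Finset.sum_ite_mem, Finset.univ_inter, Finset.sum_const, nsmul_eq_mul, mul_one]
  rw [hcard, sum_index, polarSum, polarSum, Finset.sum_range, Finset.sum_range]
  exact add_le_add
    (Finset.sum_le_sum fun k _ => key (bitBhatt_pppTransform_lowerIndex m lam n μ k))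
    (Finset.sum_le_sum fun k _ => key (bitBhatt_pppTransform_upperIndex m lam n μ k))

lemma eventually_le_card_reliablePositions (m lam : ℕ) (μ : SoftLaw) {R : ℝ}
    (hR : R < 1 - condEntropy μ) :
    ∀ᶠ n in atTop, R * (2 : ℝ) ^ (n + 1) ≤ ((reliablePositions m lam n μ).card : ℝ) := by
  -- With the gap to capacity as slack in both segments, the number of unreliable positions is at
  -- most 2^n (2H + 2ε) = 2^(n+1) (1 - R).
  have hε : 0 < 1 - condEntropy μ - R := by linarith
  filter_upwards [eventually_polarSum_unreliable m (pppCheckFamily m lam μ)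
      (fun k => by simp [pppCheckFamily]) hε one_pos,
    eventually_polarSum_unreliable m (pppVarFamily m lam μ)
      (fun k => by simp [pppVarFamily]) hε one_pos] with n h1 h2
  have h := (card_compl_reliablePositions_le m lam n μ).trans (add_le_add h1 h2)
  have hsum : (∑ k ∈ Finset.range (2 ^ m), condEntropy (pppCheckFamily m lam μ k)) / 2 ^ m +
      (∑ k ∈ Finset.range (2 ^ m), condEntropy (pppVarFamily m lam μ k)) / 2 ^ m =
      2 * condEntropy μ := by
    rw [← add_div, ← Finset.sum_add_distrib]
    simp only [pppCheckFamily, pppVarFamily, condEntropy_checkLaw_add_varLaw]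
    rw [Finset.sum_const, Finset.card_range, nsmul_eq_mul]
    push_cast
    field_simp
    ring
  have hcompl : (((reliablePositions m lam n μ)ᶜ.card : ℕ) : ℝ) =
      2 ^ (n + 1) - (reliablePositions m lam n μ).card := by
    rw [Finset.card_compl, Fintype.card_fin, Nat.cast_sub]
    · push_cast; rfl
    · simpa using Finset.card_le_univ (reliablePositions m lam n μ)
  rw [hcompl, ← mul_add] at h
  have e : (2 : ℝ) ^ n * ((∑ k ∈ Finset.range (2 ^ m), condEntropy (pppCheckFamily m lam μ k)) /
      2 ^ m + (1 - condEntropy μ - R) + ((∑ k ∈ Finset.range (2 ^ m),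
        condEntropy (pppVarFamily m lam μ k)) / 2 ^ m + (1 - condEntropy μ - R))) =
      2 ^ (n + 1) * (1 - R) := by
    rw [pow_succ]
    linear_combination (2 : ℝ) ^ n * hsum
  rw [e] at h
  linarith

/-! ### Maximum likelihood errors with known past. -/

/-- The maximum likelihood decision on the bit `i` from the past bits. -/
noncomputable def mlBit {N : ℕ} (enc : (Fin N → ZMod 2) → (Fin N → ZMod 2))
    (ℓ : Fin N → ZMod 2 → ℝ≥0) (i : Fin N) (past : Fin N → ZMod 2) : ZMod 2 :=
  if marginal enc ℓ i past 1 ≤ marginal enc ℓ i past 0 then 0 else 1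

lemma marginal_congr {N : ℕ} {enc : (Fin N → ZMod 2) → (Fin N → ZMod 2)}
    {ℓ : Fin N → ZMod 2 → ℝ≥0} {i : Fin N} {past past' : Fin N → ZMod 2}
    (h : ∀ j, j < i → past j = past' j) (b : ZMod 2) :
    marginal enc ℓ i past b = marginal enc ℓ i past' b := by
  unfold marginal
  congr 1
  ext u
  simp only [Finset.mem_filter, Finset.mem_univ, true_and]
  exact and_congr_left fun _ => forall₂_congr fun j hj => by rw [h j hj]

lemma mlBit_congr {N : ℕ} {enc : (Fin N → ZMod 2) → (Fin N → ZMod 2)}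
    {ℓ : Fin N → ZMod 2 → ℝ≥0} {i : Fin N} {past past' : Fin N → ZMod 2}
    (h : ∀ j, j < i → past j = past' j) : mlBit enc ℓ i past = mlBit enc ℓ i past' := by
  rw [mlBit, mlBit, marginal_congr h, marginal_congr h]

lemma le_sqrt_mul {x y : ℝ≥0} (h : x ≤ y) : x ≤ NNReal.sqrt (x * y) := by
  rw [NNReal.le_sqrt_iff_sq_le, sq]
  exact mul_le_mul_right h x

/-- Group the words by their past before i. Within a group the wrong decision carries the smaller of
the two marginals, which is at most their geometric mean. -/
lemma sum_mlBit_error_le_rootSum {N : ℕ} (enc : (Fin N → ZMod 2) → (Fin N → ZMod 2))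
    (ℓ : Fin N → ZMod 2 → ℝ≥0) (i : Fin N) :
    ∑ u, (if mlBit enc ℓ i u ≠ u i then ∏ k, ℓ k (enc u k) else 0) ≤ rootSum enc ℓ i := by
  have hmaps : ∀ u ∈ (Finset.univ : Finset (Fin N → ZMod 2)),
      (fun j => if j < i then u j else 0) ∈
        (Finset.univ.filter fun v : Fin N → ZMod 2 => ∀ j, i ≤ j → v j = 0) := by
    intro u _
    simp only [Finset.mem_filter, Finset.mem_univ, true_and]
    exact fun j hj => if_neg hj.not_gt
  rw [← Finset.sum_fiberwise_of_maps_to hmaps, rootSum]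
  refine Finset.sum_le_sum fun v hv => ?_
  have hv0 := (Finset.mem_filter.1 hv).2
  have hiff (u : Fin N → ZMod 2) : ((fun j => if j < i then u j else 0) = v) ↔
      ∀ j, j < i → u j = v j := by
    rw [funext_iff]
    refine forall_congr' fun j => ?_
    by_cases hj : j < i
    · simp [hj]
    · simp [hj, hv0 j (not_lt.1 hj)]
  have hinner : ∑ u with (fun j => if j < i then u j else 0) = v,
      (if mlBit enc ℓ i u ≠ u i then ∏ k, ℓ k (enc u k) else 0) =
      ∑ b, if mlBit enc ℓ i v ≠ b then marginal enc ℓ i v b else 0 := by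
    have hfib : ∀ u ∈ Finset.univ.filter fun u : Fin N → ZMod 2 =>
        (fun j => if j < i then u j else 0) = v, u i ∈ (Finset.univ : Finset (ZMod 2)) :=
      fun _ _ => Finset.mem_univ _
    rw [← Finset.sum_fiberwise_of_maps_to hfib]
    refine Finset.sum_congr rfl fun b _ => ?_
    rw [Finset.filter_filter]
    simp_rw [hiff]
    have hterm : ∀ u ∈ Finset.univ.filter fun u : Fin N → ZMod 2 =>
        (∀ j, j < i → u j = v j) ∧ u i = b,
        (if mlBit enc ℓ i u ≠ u i then ∏ k, ℓ k (enc u k) else 0) =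
          if mlBit enc ℓ i v ≠ b then ∏ k, ℓ k (enc u k) else 0 := by
      intro u hu
      obtain ⟨h1, h2⟩ := (Finset.mem_filter.1 hu).2
      rw [mlBit_congr h1, h2]
    rw [Finset.sum_congr rfl hterm]
    split_ifs
    · rfl
    · exact Finset.sum_const_zero
  rw [hinner, sum_zmod_two]
  by_cases h : marginal enc ℓ i v 1 ≤ marginal enc ℓ i v 0
  · have hml : mlBit enc ℓ i v = 0 := if_pos h
    simp only [hml, ne_eq, not_true_eq_false, if_false, zero_ne_one, not_false_eq_true, if_true,
      zero_add]
    rw [mul_comm]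
    exact le_sqrt_mul h
  · have hml : mlBit enc ℓ i v = 1 := if_neg h
    simp only [hml, ne_eq, not_true_eq_false, if_false, one_ne_zero, not_false_eq_true, if_true,
      add_zero]
    exact le_sqrt_mul (not_le.1 h).le

/-! ### From the physical channel to its soft bit, and the SC error bound. -/

namespace BinaryChannel

variable {Y : Type*} [MeasurableSpace Y] (W : BinaryChannel Y)

/-- The output density for a uniform input. -/
noncomputable def meanDensity (y : Y) : ℝ≥0 := (W.density 0 y + W.density 1 y) / 2

/-- The soft bit of the channel output. -/
noncomputable def softBit (y : Y) : SoftBit :=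
  ⟨((W.density 0 y : ℝ) - W.density 1 y) / (W.density 0 y + W.density 1 y), by
    have h0 : (0 : ℝ) ≤ W.density 0 y := (W.density 0 y).2
    have h1 : (0 : ℝ) ≤ W.density 1 y := (W.density 1 y).2
    rw [Set.mem_Icc, ← abs_le, abs_div, abs_of_nonneg (add_nonneg h0 h1)]
    exact div_le_one_of_le₀ (abs_le.2 ⟨by linarith, by linarith⟩) (add_nonneg h0 h1)⟩

lemma measurable_meanDensity : Measurable W.meanDensity :=
  ((W.measurable_density 0).add (W.measurable_density 1)).div_const 2

lemma measurable_softBit : Measurable W.softBit := by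
  have h0 := (W.measurable_density 0).coe_nnreal_real
  have h1 := (W.measurable_density 1).coe_nnreal_real
  exact ((h0.sub h1).div (h0.add h1)).subtype_mk

/-- The soft bit is a sufficient statistic: the density splits into a factor independent of the
input and the posterior. Where both densities vanish, the default soft bit 0 does no harm. -/
lemma density_eq (x : ZMod 2) (y : Y) :
    W.density x y = 2 * W.meanDensity y * posterior (W.softBit y) x := by
  apply NNReal.eq
  push_cast
  rw [coe_posterior, meanDensity, softBit]
  push_cast
  have h0 : (0 : ℝ) ≤ W.density 0 y := (W.density 0 y).2
  have h1 : (0 : ℝ) ≤ W.density 1 y := (W.density 1 y).2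
  rcases eq_or_ne ((W.density 0 y : ℝ) + W.density 1 y) 0 with h | h
  · have e0 : (W.density 0 y : ℝ) = 0 := by linarith
    have e1 : (W.density 1 y : ℝ) = 0 := by linarith
    rcases zmod_two_cases x with rfl | rfl <;> simp [e0, e1]
  · rcases zmod_two_cases x with rfl | rfl
    · rw [bitSign_zero]; field_simp; ring
    · rw [bitSign_one]; field_simp; ring

lemma isProbabilityMeasure_meanDensity :
    IsProbabilityMeasure (W.ref.withDensity fun y => (W.meanDensity y : ℝ≥0∞)) := by
  constructor
  rw [withDensity_apply _ .univ, Measure.restrict_univ]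
  have e (y : Y) : (W.meanDensity y : ℝ≥0∞) =
      (2⁻¹ : ℝ≥0∞) * ((W.density 0 y : ℝ≥0∞) + W.density 1 y) := by
    rw [meanDensity, ENNReal.coe_div two_ne_zero, ENNReal.coe_add, div_eq_mul_inv, mul_comm]
    rfl
  simp_rw [e]
  have m0 := (W.measurable_density 0).coe_nnreal_ennreal
  have m1 := (W.measurable_density 1).coe_nnreal_ennreal
  have m : Measurable fun y => (W.density 0 y : ℝ≥0∞) + W.density 1 y := m0.add m1
  rw [lintegral_const_mul _ m, lintegral_add_left m0, W.lintegral_density,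
    W.lintegral_density, one_add_one_eq_two]
  exact ENNReal.inv_mul_cancel two_ne_zero ENNReal.ofNat_ne_top

/-- The law of the soft bit of the channel output for a uniform input. -/
noncomputable def softLaw : SoftLaw :=
  ⟨(W.ref.withDensity fun y => (W.meanDensity y : ℝ≥0∞)).map W.softBit,
    have := W.isProbabilityMeasure_meanDensity
    Measure.isProbabilityMeasure_map W.measurable_softBit.aemeasurable⟩

lemma integral_softLaw {f : SoftBit → ℝ} (hf : Measurable f) :
    ∫ d, f d ∂(W.softLaw : Measure SoftBit) =
      ∫ y, (W.meanDensity y : ℝ) * f (W.softBit y) ∂W.ref := by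
  change ∫ d, f d ∂((W.ref.withDensity fun y => (W.meanDensity y : ℝ≥0∞)).map W.softBit) = _
  rw [integral_map W.measurable_softBit.aemeasurable hf.aestronglyMeasurable,
    integral_withDensity_eq_integral_smul W.measurable_meanDensity]
  rfl

/-- With p the posterior of x, the integrand is twice the mean density times p log₂(2p) = p - (-p
log₂ p). Summing over x gives 1 minus the entropy of the soft bit. -/
lemma symmetricCapacity_eq : W.symmetricCapacity = 1 - condEntropy W.softLaw := by
  set g : ZMod 2 → SoftBit → ℝ := fun x d =>
    posterior d x - Real.negMulLog (posterior d x) / Real.log 2 with hg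
  have hgm (x : ZMod 2) : Measurable (g x) :=
    (measurable_posterior x).coe_nnreal_real.sub
      ((Real.continuous_negMulLog.measurable.comp
        (measurable_posterior x).coe_nnreal_real).div_const _)
  have hlog : 0 < Real.log 2 := Real.log_pos one_lt_two
  have hL (d : SoftBit) (x : ZMod 2) : 0 ≤ Real.negMulLog (posterior d x) :=
    Real.negMulLog_nonneg (posterior d x).2 (posterior_le_one d x)
  have hgb (x : ZMod 2) (d : SoftBit) : |g x d| ≤ 1 := by
    have h1 := entropyBit_le_one d
    rw [entropyBit_eq, add_div] at h1
    have h0 (z : ZMod 2) : 0 ≤ Real.negMulLog (posterior d z) / Real.log 2 :=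
      div_nonneg (hL d z) hlog.le
    have h2 : Real.negMulLog (posterior d x) / Real.log 2 ≤ 1 := by
      rcases zmod_two_cases x with rfl | rfl
      · linarith [h0 1]
      · linarith [h0 0]
    have h3 : (posterior d x : ℝ) ≤ 1 := posterior_le_one d x
    have h4 : (0 : ℝ) ≤ posterior d x := (posterior d x).2
    rw [abs_le]
    constructor
    · change -1 ≤ (posterior d x : ℝ) - Real.negMulLog (posterior d x) / Real.log 2
      linarith
    · change (posterior d x : ℝ) - Real.negMulLog (posterior d x) / Real.log 2 ≤ 1
      linarith [h0 x]
  have hpt (x : ZMod 2) (y : Y) : (W.density x y : ℝ) * Real.logb 2 ((W.density x y : ℝ) /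
      ((1 / 2 : ℝ) * (W.density 0 y : ℝ) + (1 / 2 : ℝ) * (W.density 1 y : ℝ))) =
      2 * ((W.meanDensity y : ℝ) * g x (W.softBit y)) := by
    have hm : (1 / 2 : ℝ) * (W.density 0 y : ℝ) + (1 / 2 : ℝ) * (W.density 1 y : ℝ) =
        W.meanDensity y := by
      rw [meanDensity]; push_cast; ring
    rw [hm, W.density_eq x y, hg]
    push_cast
    -- Zero mean density or zero posterior makes the density of x vanish, and both sides are 0.
    rcases eq_or_ne (W.meanDensity y : ℝ) 0 with h | h
    · simp [h]
    · rcases eq_or_ne (posterior (W.softBit y) x : ℝ) 0 with hp | hp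
      · simp [hp]
      · have e : 2 * (W.meanDensity y : ℝ) * posterior (W.softBit y) x / W.meanDensity y =
            2 * posterior (W.softBit y) x := by field_simp
        rw [e, Real.logb, Real.log_mul two_ne_zero hp, Real.negMulLog]
        field_simp
        ring
  rw [symmetricCapacity]
  simp_rw [hpt, integral_const_mul, ← W.integral_softLaw (hgm _)]
  rw [sum_zmod_two, condEntropy]
  have hint (x : ZMod 2) : Integrable (g x) (W.softLaw : Measure SoftBit) :=
    integrable_of_bound (hgm x) (hgb x)
  have hsum : ∫ d, g 0 d ∂(W.softLaw : Measure SoftBit) +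
      ∫ d, g 1 d ∂(W.softLaw : Measure SoftBit) =
      1 - ∫ d, entropyBit d ∂(W.softLaw : Measure SoftBit) := by
    have h1 : ∫ _, (1 : ℝ) ∂(W.softLaw : Measure SoftBit) = 1 := by simp
    rw [← integral_add (hint 0) (hint 1), ← h1, ← integral_sub (integrable_const _)
      (integrable_of_bound measurable_entropyBit abs_entropyBit_le_one)]
    congr 1
    ext d
    have h2 : (posterior d 0 : ℝ) + posterior d 1 = 1 := by
      exact_mod_cast congrArg NNReal.toReal (posterior_zero_add_one d)
    rw [entropyBit_eq, hg, ← h2]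
    ring
  linarith

variable {N : ℕ} (enc : (Fin N → ZMod 2) → (Fin N → ZMod 2))

/-- The likelihoods of the symbols of the codeword, given the channel output. -/
noncomputable def likelihood (y : Fin N → Y) (k : Fin N) (x : ZMod 2) : ℝ≥0 := W.density x (y k)

lemma measurable_likelihood (k : Fin N) (x : ZMod 2) :
    Measurable fun y : Fin N → Y => W.likelihood y k x :=
  (W.measurable_density x).comp (measurable_pi_apply k)

lemma bitChannel_le_iff (i : Fin N) (y : Fin N → Y) (past : Fin N → ZMod 2) (b b' : ZMod 2) :
    W.bitChannel enc i y past b ≤ W.bitChannel enc i y past b' ↔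
      marginal enc (W.likelihood y) i past b ≤ marginal enc (W.likelihood y) i past b' :=
  mul_le_mul_iff_right₀ (by positivity)

/-- The outputs for which maximum likelihood decides the bit `i` of `u` wrongly, although the
previous bits are known. -/
def bitErrorSet (i : Fin N) (u : Fin N → ZMod 2) : Set (Fin N → Y) :=
  {y | mlBit enc (W.likelihood y) i u ≠ u i}

lemma measurableSet_bitErrorSet (i : Fin N) (u : Fin N → ZMod 2) :
    MeasurableSet (W.bitErrorSet enc i u) := by
  have h (b : ZMod 2) := measurable_marginal enc (ℓ := fun y : Fin N → Y => W.likelihood y)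
    W.measurable_likelihood i u b
  have hm : Measurable fun y : Fin N → Y => mlBit enc (W.likelihood y) i u :=
    Measurable.ite (measurableSet_le (h 1) (h 0)) measurable_const measurable_const
  exact (hm (measurableSet_singleton (u i))).compl

/-- By induction the previous decisions are correct, so the decoder sees the true past and its next
decision is the one excluded from error by assumption. -/
lemma scDecode_eq_of_notMem_bitErrorSet {A : Finset (Fin N)} {frozen u : Fin N → ZMod 2}
    (hu : ∀ i, i ∉ A → u i = frozen i) {y : Fin N → Y}
    (hy : ∀ i ∈ A, y ∉ W.bitErrorSet enc i u) (i : Fin N) :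
    W.scDecode enc A frozen y i = u i := by
  induction i using WellFoundedLT.induction with
  | ind i ih =>
    rw [scDecode]
    split_ifs with hi hle
    all_goals
      try
        have hml := not_not.1 (hy i hi)
        have hpast : mlBit enc (W.likelihood y) i
            (fun j => if _h : j < i then W.scDecode enc A frozen y j else 0) =
            mlBit enc (W.likelihood y) i u :=
          mlBit_congr fun j hj => by rw [dif_pos hj, ih j hj]
        rw [bitChannel_le_iff] at hle
        rw [← hml, ← hpast, mlBit]
    · exact (if_pos hle).symm
    · exact (if_neg hle).symm
    · exact (hu i hi).symm

lemma blockErrorProb_le (A : Finset (Fin N)) (frozen : Fin N → ZMod 2) :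
    W.blockErrorProb enc A frozen ≤ ((2 : ℝ) ^ A.card)⁻¹ *
      ∑ u : Fin N → ZMod 2 with ∀ i, i ∉ A → u i = frozen i,
        ∑ i ∈ A, (W.wordLaw (enc u)).real (W.bitErrorSet enc i u) := by
  refine mul_le_mul_of_nonneg_left (Finset.sum_le_sum fun u hu => ?_) (by positivity)
  have hprob : IsProbabilityMeasure (W.wordLaw (enc u)) := by
    unfold wordLaw; infer_instance
  calc _ ≤ (W.wordLaw (enc u)).real (⋃ i ∈ A, W.bitErrorSet enc i u) := by
        refine measureReal_mono (fun y hy => ?_) (measure_ne_top _ _)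
        by_contra hmem
        simp only [Set.mem_iUnion, not_exists] at hmem
        exact hy (funext (W.scDecode_eq_of_notMem_bitErrorSet enc (Finset.mem_filter.1 hu).2 hmem))
    _ ≤ _ := measureReal_biUnion_finset_le _ _

/-- Each word u is compatible with 2^|A| vectors `frozen`, since their values on A are free. This
turns the average over frozen bits into a uniform average over all words. -/
lemma sum_sum_filter_eq (A : Finset (Fin N)) (f : (Fin N → ZMod 2) → ℝ) :
    ∑ frozen : Fin N → ZMod 2, ∑ u : Fin N → ZMod 2 with ∀ i, i ∉ A → u i = frozen i, f u =
      2 ^ A.card * ∑ u, f u := by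
  simp_rw [Finset.sum_filter]
  rw [Finset.sum_comm, Finset.mul_sum]
  refine Finset.sum_congr rfl fun u _ => ?_
  rw [← Finset.sum_filter, Finset.sum_const, nsmul_eq_mul]
  congr 1
  have e : (Finset.univ.filter fun frozen : Fin N → ZMod 2 => ∀ i, i ∉ A → u i = frozen i) =
      Fintype.piFinset fun i => if i ∈ A then Finset.univ else {u i} := by
    ext v
    simp only [Finset.mem_filter, Finset.mem_univ, true_and, Fintype.mem_piFinset]
    refine forall_congr' fun i => ?_
    by_cases hi : i ∈ A
    · simp [hi]
    · simp [hi, eq_comm]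
  rw [e, Fintype.card_piFinset]
  have hc (i : Fin N) : (if i ∈ A then Finset.univ else {u i} : Finset (ZMod 2)).card =
      if i ∈ A then 2 else 1 := by
    split_ifs
    · rfl
    · rfl
  simp_rw [hc]
  rw [Finset.prod_ite_mem, Finset.univ_inter, Finset.prod_const]
  push_cast
  rfl

/-- Write the word laws as densities, sum over u inside the integral and use
`sum_mlBit_error_le_rootSum`. The factor 2^N comes from the 2 in `density_eq`, once per symbol. -/
lemma sum_wordLaw_bitErrorSet_le (i : Fin N) :
    ∑ u, W.wordLaw (enc u) (W.bitErrorSet enc i u) ≤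
      2 ^ N * bitBhatt enc (fun _ => W.softLaw) i := by
  have hσ := W.sigmaFinite_ref
  have hlaw (x : ZMod 2) :
      SigmaFinite (W.ref.withDensity fun y => (W.density x y : ℝ≥0∞)) :=
    inferInstanceAs (SigmaFinite (W.law x))
  have hmean := W.isProbabilityMeasure_meanDensity
  set P := Measure.pi fun _ : Fin N => W.ref
  have hword (u : Fin N → ZMod 2) : W.wordLaw (enc u) (W.bitErrorSet enc i u) =
      ∫⁻ y, ((if mlBit enc (W.likelihood y) i u ≠ u i then
        ∏ k, W.likelihood y k (enc u k) else 0 : ℝ≥0) : ℝ≥0∞) ∂P := by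
    have h := pi_withDensity (fun _ : Fin N => W.ref)
      (f := fun k y => (W.density (enc u k) y : ℝ≥0∞))
      fun k => (W.measurable_density (enc u k)).coe_nnreal_ennreal
    change Measure.pi (fun k => W.ref.withDensity fun y => (W.density (enc u k) y : ℝ≥0∞))
      (W.bitErrorSet enc i u) = _
    rw [h, withDensity_apply _ (W.measurableSet_bitErrorSet enc i u),
      ← lintegral_indicator (W.measurableSet_bitErrorSet enc i u)]
    refine lintegral_congr fun y => ?_
    by_cases hy : mlBit enc (W.likelihood y) i u ≠ u i
    · rw [Set.indicator_of_mem (show y ∈ W.bitErrorSet enc i u from hy), if_pos hy,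
        ENNReal.ofNNReal_finsetProd]
      rfl
    · rw [Set.indicator_of_notMem (show y ∉ W.bitErrorSet enc i u from hy), if_neg hy]
      rfl
  have hmeas (u : Fin N → ZMod 2) : Measurable fun y : Fin N → Y =>
      ((if mlBit enc (W.likelihood y) i u ≠ u i then
        ∏ k, W.likelihood y k (enc u k) else 0 : ℝ≥0) : ℝ≥0∞) := by
    refine Measurable.coe_nnreal_ennreal (Measurable.ite (W.measurableSet_bitErrorSet enc i u)
      (Finset.measurable_prod _ fun k _ => W.measurable_likelihood k _) measurable_const)
  have hroot (y : Fin N → Y) : (rootSum enc (W.likelihood y) i : ℝ≥0∞) =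
      2 ^ N * ((∏ k, (W.meanDensity (y k) : ℝ≥0∞)) *
        rootSum enc (fun k => posterior (W.softBit (y k))) i) := by
    have e : W.likelihood y = fun k x => (2 * W.meanDensity (y k)) *
        posterior (W.softBit (y k)) x := by
      funext k x
      exact W.density_eq x (y k)
    rw [e, rootSum_mul, Finset.prod_mul_distrib, Finset.prod_const, Finset.card_univ,
      Fintype.card_fin]
    push_cast
    rw [mul_assoc]
  have hsoft : Measurable fun (y : Fin N → Y) k => W.softBit (y k) :=
    measurable_pi_lambda _ fun k => W.measurable_softBit.comp (measurable_pi_apply k)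
  have hprod : Measurable fun y : Fin N → Y => ∏ k, (W.meanDensity (y k) : ℝ≥0∞) :=
    Finset.measurable_prod _ fun k _ =>
      W.measurable_meanDensity.coe_nnreal_ennreal.comp (measurable_pi_apply k)
  have hF := (measurable_rootSum_posterior enc i).comp hsoft
  have hbhatt : bitBhatt enc (fun _ => W.softLaw) i =
      ∫⁻ y, (∏ k, (W.meanDensity (y k) : ℝ≥0∞)) *
        rootSum enc (fun k => posterior (W.softBit (y k))) i ∂P := by
    have hmap : IsProbabilityMeasure
        ((W.ref.withDensity fun y => (W.meanDensity y : ℝ≥0∞)).map W.softBit) :=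
      Measure.isProbabilityMeasure_map W.measurable_softBit.aemeasurable
    have h := Measure.pi_map_pi (ι := Fin N)
      (μ := fun _ => W.ref.withDensity fun y => (W.meanDensity y : ℝ≥0∞))
      (f := fun _ => W.softBit) fun _ => W.measurable_softBit.aemeasurable
    change ∫⁻ d, (rootSum enc (fun k => posterior (d k)) i : ℝ≥0∞) ∂(Measure.pi fun _ =>
      (W.ref.withDensity fun y => (W.meanDensity y : ℝ≥0∞)).map W.softBit) = _
    rw [← h, lintegral_map (measurable_rootSum_posterior enc i) hsoft,
      pi_withDensity (fun _ : Fin N => W.ref) (f := fun _ y => (W.meanDensity y : ℝ≥0∞))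
        fun _ => W.measurable_meanDensity.coe_nnreal_ennreal]
    exact lintegral_withDensity_eq_lintegral_mul _ hprod hF
  calc ∑ u, W.wordLaw (enc u) (W.bitErrorSet enc i u)
      = ∫⁻ y, ∑ u, ((if mlBit enc (W.likelihood y) i u ≠ u i then
        ∏ k, W.likelihood y k (enc u k) else 0 : ℝ≥0) : ℝ≥0∞) ∂P := by
        rw [lintegral_finsetSum _ fun u _ => hmeas u]
        exact Finset.sum_congr rfl fun u _ => hword u
    _ ≤ ∫⁻ y, (rootSum enc (W.likelihood y) i : ℝ≥0∞) ∂P := by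
        refine lintegral_mono fun y => ?_
        rw [← ENNReal.ofNNReal_finsetSum]
        exact ENNReal.coe_le_coe.2 (sum_mlBit_error_le_rootSum enc (W.likelihood y) i)
    _ = 2 ^ N * bitBhatt enc (fun _ => W.softLaw) i := by
        simp_rw [hroot]
        rw [hbhatt]
        exact lintegral_const_mul _ (hprod.mul hF)

lemma avgBlockErrorProb_le (A : Finset (Fin N)) {t : ℝ} (ht : 0 ≤ t)
    (hA : ∀ i ∈ A, bitBhatt enc (fun _ => W.softLaw) i ≤ ENNReal.ofReal t) :
    W.avgBlockErrorProb enc A ≤ A.card * t := by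
  have hprob (u : Fin N → ZMod 2) : IsProbabilityMeasure (W.wordLaw (enc u)) := by
    unfold wordLaw; infer_instance
  have hbit : ∀ i ∈ A, ∑ u, (W.wordLaw (enc u)).real (W.bitErrorSet enc i u) ≤ 2 ^ N * t := by
    intro i hi
    have h := (W.sum_wordLaw_bitErrorSet_le enc i).trans (mul_le_mul_right (hA i hi) _)
    have e : (2 : ℝ≥0∞) ^ N * ENNReal.ofReal t = ENNReal.ofReal (2 ^ N * t) := by
      rw [ENNReal.ofReal_mul (by positivity), ENNReal.ofReal_pow zero_le_two, ENNReal.ofReal_ofNat]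
    rw [e] at h
    have h' := ENNReal.toReal_le_of_le_ofReal (by positivity) h
    rwa [ENNReal.toReal_sum fun u _ => measure_ne_top _ _] at h'
  calc W.avgBlockErrorProb enc A
      ≤ ((2 : ℝ) ^ N)⁻¹ * ∑ frozen : Fin N → ZMod 2, ((2 : ℝ) ^ A.card)⁻¹ *
        ∑ u : Fin N → ZMod 2 with ∀ i, i ∉ A → u i = frozen i,
          ∑ i ∈ A, (W.wordLaw (enc u)).real (W.bitErrorSet enc i u) :=
        mul_le_mul_of_nonneg_left
          (Finset.sum_le_sum fun frozen _ => W.blockErrorProb_le enc A frozen) (by positivity)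
    _ = ((2 : ℝ) ^ N)⁻¹ *
        ∑ i ∈ A, ∑ u, (W.wordLaw (enc u)).real (W.bitErrorSet enc i u) := by
        rw [← Finset.mul_sum, sum_sum_filter_eq, inv_mul_cancel_left₀ (by positivity),
          Finset.sum_comm]
    _ ≤ ((2 : ℝ) ^ N)⁻¹ * ∑ i ∈ A, 2 ^ N * t :=
        mul_le_mul_of_nonneg_left (Finset.sum_le_sum hbit) (by positivity)
    _ = A.card * t := by
        rw [Finset.sum_const, nsmul_eq_mul]
        field_simp

lemma blockErrorProb_nonneg (A : Finset (Fin N)) (frozen : Fin N → ZMod 2) :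
    0 ≤ W.blockErrorProb enc A frozen :=
  mul_nonneg (by positivity) (Finset.sum_nonneg fun _ _ => measureReal_nonneg)

lemma exists_blockErrorProb_le_avg (A : Finset (Fin N)) :
    ∃ frozen, W.blockErrorProb enc A frozen ≤ W.avgBlockErrorProb enc A := by
  by_contra! h
  have hlt := Finset.sum_lt_sum_of_nonempty (Finset.univ_nonempty (α := Fin N → ZMod 2))
    fun frozen _ => h frozen
  rw [Finset.sum_const, nsmul_eq_mul, Finset.card_univ, Fintype.card_fun, ZMod.card,
    Fintype.card_fin, avgBlockErrorProb] at hlt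
  push_cast at hlt
  rw [mul_inv_cancel_left₀ (by positivity)] at hlt
  exact lt_irrefl _ hlt

end BinaryChannel

/-! ### Choice of information sets and frozen bits. -/

theorem theorem1 {Y : Type*} [MeasurableSpace Y] (W : BinaryChannel Y)
    (m lam : ℕ) (hlam : lam ≤ 2 ^ m) (R : ℝ) (hR : R < W.symmetricCapacity) :
    ∃ A : (n : ℕ) → Finset (Fin (2 ^ (n + 1))),
      (∀ n, R * (2 : ℝ) ^ (n + 1) ≤ ((A n).card : ℝ)) ∧
      Tendsto (fun n => W.avgBlockErrorProb (pppTransform m lam n) (A n)) atTop (𝓝 0) ∧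
      ∃ frozen : (n : ℕ) → Fin (2 ^ (n + 1)) → ZMod 2,
        Tendsto (fun n => W.blockErrorProb (pppTransform m lam n) (A n) (frozen n))
          atTop (𝓝 0) := by
  classical
  rw [W.symmetricCapacity_eq] at hR
  have hR1 : R ≤ 1 := by linarith [(condEntropy_mem W.softLaw).1]
  set G := fun n => reliablePositions m lam n W.softLaw
  -- The rate condition is required for every n, but the reliable positions satisfy it only
  -- eventually. For the finitely many other n all positions are taken, which suffices as R ≤ 1.
  set A : (n : ℕ) → Finset (Fin (2 ^ (n + 1))) := fun n =>
    if R * (2 : ℝ) ^ (n + 1) ≤ ((G n).card : ℝ) then G n else Finset.univ with hA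
  have hAG : ∀ᶠ n in atTop, A n = G n :=
    (eventually_le_card_reliablePositions m lam W.softLaw hR).mono fun n hn => if_pos hn
  have hnonneg (n : ℕ) : 0 ≤ W.avgBlockErrorProb (pppTransform m lam n) (A n) :=
    mul_nonneg (by positivity) (Finset.sum_nonneg fun _ _ => W.blockErrorProb_nonneg _ _ _)
  have havg : Tendsto (fun n => W.avgBlockErrorProb (pppTransform m lam n) (A n)) atTop (𝓝 0) := by
    have hlim : Tendsto (fun n : ℕ => 2 * (1 / 2 : ℝ) ^ n) atTop (𝓝 0) := by
      simpa using (tendsto_pow_atTop_nhds_zero_of_lt_one (by norm_num)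
        (by norm_num : (1 / 2 : ℝ) < 1)).const_mul 2
    refine tendsto_of_tendsto_of_tendsto_of_le_of_le' tendsto_const_nhds hlim
      (Eventually.of_forall hnonneg) (hAG.mono fun n hn => ?_)
    rw [hn]
    refine (W.avgBlockErrorProb_le _ (G n) (by positivity)
      fun i hi => mem_reliablePositions.1 hi).trans ?_
    have hcard : ((G n).card : ℝ) ≤ 2 ^ (n + 1) := by
      exact_mod_cast (Finset.card_le_univ (G n)).trans_eq (Fintype.card_fin _)
    calc ((G n).card : ℝ) * (1 / 4 ^ n) ≤ 2 ^ (n + 1) * (1 / 4 ^ n) := by gcongr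
      _ = 2 * (1 / 2 : ℝ) ^ n := by
        rw [show (4 : ℝ) = 2 * 2 by norm_num, mul_pow, div_pow, one_pow, pow_succ]
        field_simp
  choose frozen hfrozen using fun n =>
    W.exists_blockErrorProb_le_avg (pppTransform m lam n) (A n)
  refine ⟨A, fun n => ?_, havg, frozen, ?_⟩
  · by_cases h : R * (2 : ℝ) ^ (n + 1) ≤ ((G n).card : ℝ)
    · rw [hA]; simpa only [if_pos h] using h
    · rw [hA]
      simp only [if_neg h, Finset.card_univ, Fintype.card_fin]
      push_cast
      exact mul_le_of_le_one_left (by positivity) hR1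
  · exact squeeze_zero (fun n => W.blockErrorProb_nonneg _ _ _) hfrozen havg
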